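/- Let $G$ be a semitopological semigroup (a semigroup with a topology for which multiplication is separately continuous), and let $G$ act on a compact Hausdorff space $K$, i.e. there is a continuous map $G\times K\to K$, $(g,x)\mapsto gx$, with $(g_1g_2)x=g_1(g_2x)$. Assume that there is a mean $m$ on the space $C_b(G)$ of bounded continuous functions $G\to\mathbb C$ (a continuous linear functional with $m(\mathbf 1)=\|m\|=1$) such that $m(h\mapsto f(gh))=m(f)$ for all $f\in C_b(G)$ and $g\in G$. (Since the Koopman operators $S_gf=f(g\,\cdot)$ satisfy $S_{g_1}S_{g_2}=S_{g_2g_1}$, this is the invariance that makes the operator semigroups below right amenable; it holds in particular if $G$ is amenable, i.e. if there is a two-sided invariant mean.) Assume that the action is uniquely ergodic, i.e. that there is exactly one $G$-invariant regular Borel probability measure $\mu$ on $K$. Let $\Omega$ be a compact (Hausdorff) group and $\gamma:G\times K\to\Omega$ a continuous cocycle, i.e. a continuous map with $\gamma(g_1g_2,x)=\gamma(g_2,x)\gamma(g_1,g_2x)$ for all $g_1,g_2\in G$ and $x\in K$. Let $\mathcal T=\{T_g:g\in G\}$ be the Koopman semigroup of the skew product action on $C(K\times\Omega)$, $T_gF(x,\omega)=F(gx,\omega\gamma(g,x))$.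 It is called mean ergodic if the closure $\overline{\mathrm{co}}\,\mathcal T$ of its convex hull in the strong operator topology contains a zero element, i.e. some $P$ with $PQ=QP=P$ for all $Q\in\overline{\mathrm{co}}\,\mathcal T$. For $N\in\mathbb N$ let $\mathrm{Rep}(\Omega,N)$ be the set of irreducible continuous unitary representations $\pi:\Omega\to U(N)$ of $\Omega$ on $\mathbb C^N$ with its Euclidean inner product. For $\pi\in\mathrm{Rep}(\Omega,N)$ let $(\pi\circ\gamma)\mathcal S^{(N)}$ be the semigroup of the operators $$f\mapsto \big(x\mapsto \pi(\gamma(g,x))f(gx)\big)\qquad(g\in G)$$ on $C(K,\mathbb C^N)$, and $(\pi\circ\gamma)\mathcal S_2^{(N)}$ the semigroup of their continuous extensions to $L^2(K,\mathbb C^N,\mu)$. Write $\operatorname{Fix}$ for the space of common fixed vectors of a semigroup of operators. Then the following assertions are equivalent: 1. $\mathcal T$ is mean ergodic on $C(K\times\Omega)$. 2. $\operatorname{Fix}(\pi\circ\gamma)\mathcal S_2^{(N)}\subseteq\operatorname{Fix}(\pi\circ\gamma)\mathcal S^{(N)}$ for every $N\in\mathbb N$ and every $\pi\in\mathrm{Rep}(\Omega,N)$;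 that is, every $h\in L^2(K,\mathbb C^N,\mu)$ fixed by $(\pi\circ\gamma)\mathcal S_2^{(N)}$ is the $\mu$-class of some $f\in C(K,\mathbb C^N)$ fixed by $(\pi\circ\gamma)\mathcal S^{(N)}$. -/

import Mathlib

open MeasureTheory Topology Set
open scoped ENNReal BoundedContinuousFunction

noncomputable section

namespace SkewErgodic

/-- `ℂ^N` with its Euclidean norm. -/
abbrev CN (N : ℕ) : Type := EuclideanSpace ℂ (Fin N)

/-- The group `U(N)` of unitary operators on `ℂ^N`. -/
abbrev UN (N : ℕ) : Type := unitary (CN N →L[ℂ] CN N)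

/-! ### Amenability -/

section Amenability

variable {G : Type*} [Semigroup G] [TopologicalSpace G] [SeparatelyContinuousMul G]

/-- The translate `h ↦ f (g * h)` of a bounded continuous function `f`. -/
def translate (g : G) (f : G →ᵇ ℂ) : G →ᵇ ℂ :=
  f.compContinuous ⟨fun h => g * h, continuous_const_mul g⟩

/-- A mean on `C_b(G)`: a continuous linear functional `m` with `m 1 = ‖m‖ = 1`. -/
def IsMean (m : (G →ᵇ ℂ) →L[ℂ] ℂ) : Prop :=
  m 1 = 1 ∧ ‖m‖ = 1

variable (G) in
/-- There is a mean `m` on `C_b(G)` with `m (h ↦ f (g * h)) = m f` for all `f` and `g`.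
As Koopman operators satisfy `S g₁ ∘ S g₂ = S (g₂ * g₁)`, the map `h ↦ g * h` of `G` corresponds to
the right translation `T ↦ T ∘ S g` of the operator semigroup: this is the condition on `G` under
which its Koopman semigroups are right amenable. -/
def KoopmanRightAmenable : Prop :=
  ∃ m : (G →ᵇ ℂ) →L[ℂ] ℂ, IsMean m ∧ ∀ (g : G) (f : G →ᵇ ℂ), m (translate g f) = m f

end Amenability

/-! ### Operator semigroups: fixed spaces and mean ergodicity -/

section Operators

variable {ι X : Type*} [NormedAddCommGroup X] [NormedSpace ℂ X]

/-- The fixed space of a family of operators. -/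
def fixedSpace (T : ι → X →L[ℂ] X) : Submodule ℂ X where
  carrier := {f | ∀ i, T i f = f}
  add_mem' := by
    intro a b ha hb i
    rw [map_add, ha i, hb i]
  zero_mem' := fun i => map_zero (T i)
  smul_mem' := by
    intro c a ha i
    rw [map_smul, ha i]

/-- The closure of a set of operators in the strong operator topology. -/
def sotClosure (A : Set (X →L[ℂ] X)) : Set (X →L[ℂ] X) :=
  {P | ContinuousLinearMap.toPointwiseConvergenceCLM ℂ (RingHom.id ℂ) X X P ∈
    closure (ContinuousLinearMap.toPointwiseConvergenceCLM ℂ (RingHom.id ℂ) X X '' A)}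

/-- The operator semigroup `{T i}` is mean ergodic: the strong operator closure of its convex hull
contains a zero element. -/
def IsMeanErgodic (T : ι → X →L[ℂ] X) : Prop :=
  ∃ P ∈ sotClosure (convexHull ℝ (range T)),
    ∀ Q ∈ sotClosure (convexHull ℝ (range T)), P ∘L Q = P ∧ Q ∘L P = P

end Operators

/-! ### Invariant measures -/

section UniqueErgodicity

/-- There is exactly one `G`-invariant regular Borel probability measure on `K`. -/
def IsUniquelyErgodic (G K : Type*) [SMul G K] [TopologicalSpace K] [MeasurableSpace K] : Prop :=
  ∃! μ : Measure K, IsProbabilityMeasure μ ∧ μ.Regular ∧ SMulInvariantMeasure G K μ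

end UniqueErgodicity

/-! ### Cocycles -/

/-- Continuous cocycles `γ : G × K → Ω` of a semigroup action. -/
structure ContinuousCocycle (G K Ω : Type*) [Semigroup G] [TopologicalSpace G]
    [TopologicalSpace K] [SemigroupAction G K] [Monoid Ω] [TopologicalSpace Ω] where
  toFun : G → K → Ω
  continuous_toFun : Continuous fun p : G × K => toFun p.1 p.2
  map_mul : ∀ (g₁ g₂ : G) (x : K), toFun (g₁ * g₂) x = toFun g₂ x * toFun g₁ (g₂ • x)

section Action

variable {G K Ω : Type*} [Semigroup G] [TopologicalSpace G] [TopologicalSpace K]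
  [SemigroupAction G K]

section Cocycle

variable [Monoid Ω] [TopologicalSpace Ω]

theorem ContinuousCocycle.continuous_right (γ : ContinuousCocycle G K Ω) (g : G) :
    Continuous (γ.toFun g) :=
  γ.continuous_toFun.comp (Continuous.prodMk_right g)

/-- The cocycle `π ∘ γ`, for a continuous homomorphism `π`. -/
def ContinuousCocycle.map {Ω' : Type*} [Monoid Ω'] [TopologicalSpace Ω']
    (π : Ω →ₜ* Ω') (γ : ContinuousCocycle G K Ω) : ContinuousCocycle G K Ω' where
  toFun g x := π (γ.toFun g x)
  continuous_toFun := π.continuous_toFun.comp γ.continuous_toFun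
  map_mul g₁ g₂ x := by rw [γ.map_mul, _root_.map_mul]

/-! ### The skew product action and its Koopman semigroup -/

variable [ContinuousSMul G K] [ContinuousMul Ω]

/-- The skew product action `g (x, ω) = (g x, ω γ(g, x))` on `K × Ω`. -/
def skewMap (γ : ContinuousCocycle G K Ω) (g : G) : C(K × Ω, K × Ω) where
  toFun p := (g • p.1, p.2 * γ.toFun g p.1)
  continuous_toFun :=
    (continuous_fst.const_smul g).prodMk
      (continuous_snd.mul ((γ.continuous_right g).comp continuous_fst))

/-- The skew product Koopman operator `T_g F = F ∘ (skew product action of g)` on `C(K × Ω)`. -/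
def skewKoopman [CompactSpace K] [CompactSpace Ω] (γ : ContinuousCocycle G K Ω) (g : G) :
    C(K × Ω, ℂ) →L[ℂ] C(K × Ω, ℂ) :=
  ContinuousMap.compCLM ℂ ℂ (skewMap γ g)

end Cocycle

/-! ### The operators `γ(g, ·) S_g` on `C(K, ℂ^N)` and on `L²(K, ℂ^N, μ)` -/

section Weighted

variable {N : ℕ}

/-- The function `x ↦ γ(g, x) f(g x)`. -/
def twist (γ : ContinuousCocycle G K (UN N)) (g : G) (f : K → CN N) (x : K) : CN N :=
  (γ.toFun g x : CN N →L[ℂ] CN N) (f (g • x))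

theorem continuous_twist [ContinuousSMul G K] (γ : ContinuousCocycle G K (UN N)) (g : G) {f : K → CN N}
    (hf : Continuous f) : Continuous (twist γ g f) :=
  (continuous_subtype_val.comp (γ.continuous_right g)).clm_apply
    (hf.comp (continuous_id.const_smul g))

theorem norm_twist (γ : ContinuousCocycle G K (UN N)) (g : G) (f : K → CN N) (x : K) :
    ‖twist γ g f x‖ = ‖f (g • x)‖ :=
  ContinuousLinearMap.norm_map_of_mem_unitary (γ.toFun g x).2 (f (g • x))

/-- The operator `γ(g, ·) S_g` on `C(K, ℂ^N)`. -/
def koopmanC [ContinuousSMul G K] [CompactSpace K] (γ : ContinuousCocycle G K (UN N)) (g : G) :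
    C(K, CN N) →L[ℂ] C(K, CN N) :=
  LinearMap.mkContinuous
    { toFun := fun f => ⟨twist γ g f, continuous_twist γ g f.continuous⟩
      map_add' := fun f f' => by ext1 x; simp [twist]
      map_smul' := fun c f => by ext1 x; simp [twist] } 1
    (fun f => by
      rw [one_mul]
      refine (ContinuousMap.norm_le _ (norm_nonneg f)).2 fun x => ?_
      exact (norm_twist γ g f x).trans_le (f.norm_coe_le_norm (g • x)))

variable [ContinuousSMul G K] [MeasurableSpace K] [BorelSpace K] {μ : Measure K} [SMulInvariantMeasure G K μ]

variable (K μ) in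
theorem measurePreserving_act (g : G) : MeasurePreserving (fun x : K => g • x) μ μ where
  measurable := (continuous_const_smul g).measurable
  map_eq := by
    ext s hs
    rw [Measure.map_apply (continuous_const_smul g).measurable hs]
    exact SMulInvariantMeasure.measure_preimage_smul g hs

theorem memLp_twist (γ : ContinuousCocycle G K (UN N)) (g : G) {f : K → CN N}
    (hf : MemLp f 2 μ) : MemLp (twist γ g f) 2 μ := by
  have h := hf.comp_measurePreserving (measurePreserving_act K μ g)
  refine h.of_le ?_ (Filter.Eventually.of_forall fun x => (norm_twist γ g f x).le)
  have hγ : AEStronglyMeasurable (fun x => (γ.toFun g x : CN N →L[ℂ] CN N)) μ :=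
    (continuous_subtype_val.comp (γ.continuous_right g)).aestronglyMeasurable
  exact (ContinuousLinearMap.id ℂ (CN N →L[ℂ] CN N)).aestronglyMeasurable_comp₂ hγ h.1

theorem twist_congr_ae (γ : ContinuousCocycle G K (UN N)) (g : G) {f f' : K → CN N}
    (h : f =ᵐ[μ] f') : twist γ g f =ᵐ[μ] twist γ g f' := by
  filter_upwards [(measurePreserving_act K μ g).quasiMeasurePreserving.ae_eq_comp h] with x hx
  exact congrArg (γ.toFun g x : CN N →L[ℂ] CN N) hx

variable (μ) in
/-- The operator `γ(g, ·) S_{g,2}` on `L²(K, ℂ^N, μ)`. -/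
def koopmanL2 (γ : ContinuousCocycle G K (UN N)) (g : G) :
    Lp (CN N) 2 μ →L[ℂ] Lp (CN N) 2 μ :=
  LinearMap.mkContinuous
    { toFun := fun f => (memLp_twist γ g (Lp.memLp f)).toLp _
      map_add' := fun f f' => by
        rw [← MemLp.toLp_add]
        refine MemLp.toLp_congr _ _ ((twist_congr_ae γ g (Lp.coeFn_add f f')).trans ?_)
        exact Filter.Eventually.of_forall fun x => by simp [twist]
      map_smul' := fun c f => by
        rw [RingHom.id_apply, ← MemLp.toLp_const_smul]
        refine MemLp.toLp_congr _ _ ((twist_congr_ae γ g (Lp.coeFn_smul c f)).trans ?_)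
        exact Filter.Eventually.of_forall fun x => by simp [twist] } 1
    (fun f => by
      rw [one_mul]
      have h := Lp.norm_compMeasurePreserving f (measurePreserving_act K μ g)
      rw [← h]
      refine Lp.norm_le_norm_of_ae_le ?_
      filter_upwards [(memLp_twist γ g (Lp.memLp f)).coeFn_toLp,
        Lp.coeFn_compMeasurePreserving f (measurePreserving_act K μ g)] with x h1 h2
      rw [h2]
      exact ((congrArg norm h1).trans (norm_twist γ g f x)).le)

theorem koopmanL2_coeFn (γ : ContinuousCocycle G K (UN N)) (g : G) (f : Lp (CN N) 2 μ) :
    koopmanL2 μ γ g f =ᵐ[μ] fun x => (γ.toFun g x : CN N →L[ℂ] CN N) (f (g • x)) :=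
  (memLp_twist γ g (Lp.memLp f)).coeFn_toLp

/-- The operator on `L²` extends the operator on `C(K, ℂ^N)`. -/
theorem koopmanL2_toLp [CompactSpace K] [IsFiniteMeasure μ]
    (γ : ContinuousCocycle G K (UN N)) (g : G) (f : C(K, CN N)) :
    koopmanL2 μ γ g (ContinuousMap.toLp 2 μ ℂ f) =
      ContinuousMap.toLp 2 μ ℂ (koopmanC γ g f) := by
  refine Lp.ext ((koopmanL2_coeFn γ g _).trans ?_)
  exact (twist_congr_ae γ g (ContinuousMap.coeFn_toLp μ f)).trans
    (ContinuousMap.coeFn_toLp μ (koopmanC γ g f)).symm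

end Weighted

end Action

/-! ### Irreducible representations -/

/-- `Rep(Ω, N)`: the irreducible (continuous, unitary) representations of `Ω` on `ℂ^N`. -/
def irreps (Ω : Type*) [Group Ω] [TopologicalSpace Ω] (N : ℕ) : Set (Ω →ₜ* UN N) :=
  {π | Representation.IsIrreducible
    (((ContinuousLinearMap.toLinearMapRingHom (R₁ := ℂ) (M₁ := CN N) :
      (CN N →L[ℂ] CN N) →* (CN N →ₗ[ℂ] CN N)).comp
        (unitary (CN N →L[ℂ] CN N)).subtype).comp (π : Ω →* UN N))}

end SkewErgodic

end

/-!
Why the theorem is true.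

*Weak averages.* For a contraction semigroup `T` indexed by `G` with `T (g h) = T h ∘ T g`, the
invariant mean turns every functional `φ` into the invariant functional `x ↦ m (g ↦ φ (T g x))`
(`averageDual`). A fixed vector in the closed convex hull of the orbit of `x` is therefore
determined by `x`, linearly and contractively, and the vectors admitting one form a closed
subspace. If this subspace is everything, the resulting map is the zero element of the strongly
closed convex hull: `isMeanErgodic_of_dense_span`. So mean ergodicity only has to be tested on
a total set of vectors.

*Decomposition along representations.* For a representation `π` of `Ω` on `ℂ^N` and `v ∈ ℂ^N`, the
map `f ↦ ((x, ω) ↦ ⟪v, π(ω) f(x)⟫)` (`coordMap`) intertwines the operators `π(γ(g, ·)) S_g` with the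
skew product Koopman operators. By the Peter–Weyl theorem and the density of `C(K) ⊗ C(Ω)` in
`C(K × Ω)`, the ranges of these maps for irreducible `π` are total (`dense_span_coordMap`). Hence
mean ergodicity of the skew product amounts to the existence of fixed functions in the closed convex
hulls of all orbits in `C(K, ℂ^N)`, for all irreducible `π`; for one direction see
`exists_fixed_of_isMeanErgodic`.

*Comparison with `L²`.* Fixed vectors in closed convex hulls of orbits always exist in `L²`: take
the element of minimal norm. If this vector is a fixed continuous function `f₀`, then some convex
combination of the orbit of `f - f₀` is small in `L²`. By unique ergodicity, convex combinations of
the translates of the square of its norm are uniformly small, and Jensen's inequality transfers this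
to a further convex combination of the orbit: `exists_fixed_mem_closure_koopmanC`. Conversely, the
fixed functions arising from a dense set of continuous functions are dense among the fixed vectors
in `L²`; unique ergodicity makes the norm of a fixed continuous function constant, so these
functions form a closed subspace of `L²`, which is then all of the fixed space:
`fixedSpace_koopmanL2_le`.

*Unique ergodicity* enters through `averageReal_eq_integral`: the average of a state of `C(K)` along
its orbit is an invariant state, and by the Riesz–Markov–Kakutani theorem this is `μ`.

*Peter–Weyl* (`dense_matrixCoeffSpan`): convolution by a symmetric continuous function is a compact
self-adjoint operator on `L²(Ω)` commuting with right translations, so its eigenspaces for nonzero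
eigenvalues are finite-dimensional and invariant, hence consist of sums of matrix coefficients of
irreducible representations; by the spectral theorem these approximate every convolution, and
convolutions approximate every continuous function.
-/

noncomputable section

namespace SkewErgodic

/-! ### Strong operator closures and convex hulls of orbits -/

section Operators

variable {ι X : Type*} [NormedAddCommGroup X] [NormedSpace ℂ X]

theorem mem_sotClosure_iff {A : Set (X →L[ℂ] X)} {P : X →L[ℂ] X} :
    P ∈ sotClosure A ↔ ∀ s : Set X, s.Finite → ∀ ε > 0, ∃ B ∈ A, ∀ x ∈ s, ‖B x - P x‖ < ε := by
  have hb : (𝓝 (P : X → X)).HasBasis (fun i : Set X × (X → ℝ) => i.1.Finite ∧ ∀ x ∈ i.1, 0 < i.2 x)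
      (fun i => i.1.pi fun x => Metric.ball (P x) (i.2 x)) := by
    rw [nhds_pi]
    exact Filter.hasBasis_pi fun x => Metric.nhds_basis_ball
  have h0 : P ∈ sotClosure A ↔ (P : X → X) ∈ closure ((fun B : X →L[ℂ] X => (B : X → X)) '' A) := by
    unfold sotClosure
    rw [mem_ofPred_eq,
      (PointwiseConvergenceCLM.isEmbedding_coeFn (RingHom.id ℂ) X X).closure_eq_preimage_closure_image,
      mem_preimage, image_image]
    rfl
  rw [h0, mem_closure_iff_nhds_basis hb]
  constructor
  · intro h s hs ε hε
    obtain ⟨_, ⟨B, hB, rfl⟩, h'⟩ := h (s, fun _ => ε) ⟨hs, fun _ _ => hε⟩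
    exact ⟨B, hB, fun x hx => by simpa [dist_eq_norm] using h' x hx⟩
  · rintro h ⟨s, δ⟩ ⟨hs, hδ⟩
    rcases s.eq_empty_or_nonempty with rfl | hne
    · obtain ⟨B, hB, -⟩ := h ∅ finite_empty 1 one_pos
      exact ⟨_, ⟨B, hB, rfl⟩, by simp⟩
    · obtain ⟨x₀, hx₀, hmin⟩ := exists_min_image s δ hs hne
      obtain ⟨B, hB, h'⟩ := h s hs (δ x₀) (hδ x₀ hx₀)
      refine ⟨_, ⟨B, hB, rfl⟩, fun x hx => ?_⟩
      simpa [dist_eq_norm] using (h' x hx).trans_le (hmin x hx)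

/-- Evaluation at `x`, as a real-linear map on operators. -/
def evalLM (x : X) : (X →L[ℂ] X) →ₗ[ℝ] X where
  toFun B := B x
  map_add' _ _ := rfl
  map_smul' _ _ := rfl

theorem image_eval_convexHull (T : ι → X →L[ℂ] X) (x : X) :
    (fun B : X →L[ℂ] X => B x) '' convexHull ℝ (range T) = convexHull ℝ (range fun i => T i x) := by
  have := (evalLM x).image_convexHull (range T)
  rw [← range_comp] at this
  exact this

theorem apply_mem_closure_of_mem_sotClosure {A : Set (X →L[ℂ] X)} {P : X →L[ℂ] X}
    (hP : P ∈ sotClosure A) (x : X) : P x ∈ closure ((fun B : X →L[ℂ] X => B x) '' A) := by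
  rw [Metric.mem_closure_iff]
  intro ε hε
  obtain ⟨B, hB, h⟩ := mem_sotClosure_iff.1 hP {x} (finite_singleton x) ε hε
  exact ⟨B x, ⟨B, hB, rfl⟩, by simpa [dist_eq_norm, norm_sub_rev] using h x rfl⟩

theorem mem_closure_convexHull_of_mem_sotClosure {T : ι → X →L[ℂ] X} {P : X →L[ℂ] X}
    (hP : P ∈ sotClosure (convexHull ℝ (range T))) (x : X) :
    P x ∈ closure (convexHull ℝ (range fun i => T i x)) := by
  rw [← image_eval_convexHull]
  exact apply_mem_closure_of_mem_sotClosure hP x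

theorem subset_sotClosure {A : Set (X →L[ℂ] X)} : A ⊆ sotClosure A := fun P hP =>
  mem_sotClosure_iff.2 fun _ _ _ hε => ⟨P, hP, fun _ _ => by simpa using hε⟩

/-- Convex combinations of contractions are contractions. -/
theorem norm_apply_le_of_mem_convexHull {T : ι → X →L[ℂ] X} (hT : ∀ i x, ‖T i x‖ ≤ ‖x‖)
    {B : X →L[ℂ] X} (hB : B ∈ convexHull ℝ (range T)) (x : X) : ‖B x‖ ≤ ‖x‖ := by
  have h : B x ∈ convexHull ℝ (range fun i => T i x) := by
    rw [← image_eval_convexHull]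
    exact ⟨B, hB, rfl⟩
  have : convexHull ℝ (range fun i => T i x) ⊆ Metric.closedBall 0 ‖x‖ :=
    convexHull_min (by rintro _ ⟨i, rfl⟩; simpa using hT i x) (convex_closedBall 0 ‖x‖)
  simpa using this h

theorem apply_eq_of_mem_fixedSpace {T : ι → X →L[ℂ] X} {x : X} (hx : x ∈ fixedSpace T)
    {Q : X →L[ℂ] X} (hQ : Q ∈ sotClosure (convexHull ℝ (range T))) : Q x = x := by
  have h := mem_closure_convexHull_of_mem_sotClosure hQ x
  have : closure (convexHull ℝ (range fun i => T i x)) ⊆ {x} :=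
    closure_minimal (convexHull_min (by rintro _ ⟨i, rfl⟩; exact hx i) (convex_singleton x))
      isClosed_singleton
  exact this h

/-- An operator absorbing each `T i` from the right absorbs the strong closure of their convex
hull. -/
theorem comp_eq_of_mem_sotClosure {T : ι → X →L[ℂ] X} {P : X →L[ℂ] X}
    (hP : ∀ i x, P (T i x) = P x) {Q : X →L[ℂ] X}
    (hQ : Q ∈ sotClosure (convexHull ℝ (range T))) (x : X) : P (Q x) = P x := by
  have h := mem_closure_convexHull_of_mem_sotClosure hQ x
  have : closure (convexHull ℝ (range fun i => T i x)) ⊆ P ⁻¹' {P x} :=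
    closure_minimal (convexHull_min (by rintro _ ⟨i, rfl⟩; exact hP i x)
      ((convex_singleton (P x)).linear_preimage (P.toLinearMap.restrictScalars ℝ)))
      (isClosed_singleton.preimage P.continuous)
  exact this h

theorem map_mem_closure_convexHull {Y : Type*} [NormedAddCommGroup Y] [NormedSpace ℂ Y]
    (J : X →L[ℂ] Y) {u : ι → X} {x : X} (hx : x ∈ closure (convexHull ℝ (range u))) :
    J x ∈ closure (convexHull ℝ (range fun i => J (u i))) := by
  have h1 := image_closure_subset_closure_image J.continuous (mem_image_of_mem J hx)
  have h2 := (J.toLinearMap.restrictScalars ℝ).image_convexHull (range u)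
  rw [← range_comp] at h2
  have h3 : J '' convexHull ℝ (range u) = convexHull ℝ (range fun i => J (u i)) := h2
  rwa [h3] at h1

/-- The convex hull of an operator semigroup is a semigroup. -/
theorem comp_mem_convexHull {G : Type*} [Semigroup G] {T : G → X →L[ℂ] X}
    (hmul : ∀ g h x, T (g * h) x = T h (T g x))
    {A B : X →L[ℂ] X} (hA : A ∈ convexHull ℝ (range T)) (hB : B ∈ convexHull ℝ (range T)) :
    A ∘L B ∈ convexHull ℝ (range T) := by
  let R (B : X →L[ℂ] X) : (X →L[ℂ] X) →ₗ[ℝ] (X →L[ℂ] X) :=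
    { toFun := fun A => A ∘L B, map_add' := fun _ _ => rfl, map_smul' := fun _ _ => rfl }
  let L (A : X →L[ℂ] X) : (X →L[ℂ] X) →ₗ[ℝ] (X →L[ℂ] X) :=
    { toFun := fun B => A ∘L B
      map_add' := fun _ _ => by ext; simp
      map_smul' := fun c B => by ext x; simp [← Complex.coe_smul] }
  have h1 : ∀ g, range T ⊆ L (T g) ⁻¹' convexHull ℝ (range T) := by
    rintro g _ ⟨h, rfl⟩
    exact subset_convexHull ℝ _ ⟨h * g, by ext x; exact hmul h g x⟩
  have h2 : range T ⊆ R B ⁻¹' convexHull ℝ (range T) := by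
    rintro _ ⟨g, rfl⟩
    exact convexHull_min (h1 g) ((convex_convexHull ℝ _).linear_preimage (L (T g))) hB
  exact convexHull_min h2 ((convex_convexHull ℝ _).linear_preimage (R B)) hA

end Operators

/-! ### Means and averages of orbits -/

section Mean

variable {G : Type*} [TopologicalSpace G]

/-- A mean is positive: with `Re f ≥ 0` and `‖f‖ ≤ M` one has `‖f - t‖² ≤ M² + t²` for `t > 0`, so
`Re (m f) ≥ - M² / 2t`. -/
theorem IsMean.re_nonneg [Semigroup G] [SeparatelyContinuousMul G] {m : (G →ᵇ ℂ) →L[ℂ] ℂ}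
    (hm : IsMean m) {f : G →ᵇ ℂ} (hf : ∀ g, 0 ≤ (f g).re) : 0 ≤ (m f).re := by
  have key : ∀ t : ℝ, 0 < t → ((m f).re - t) ^ 2 ≤ ‖f‖ ^ 2 + t ^ 2 := by
    intro t ht
    have h1 : ‖f - (t : ℂ) • (1 : G →ᵇ ℂ)‖ ≤ Real.sqrt (‖f‖ ^ 2 + t ^ 2) := by
      refine (BoundedContinuousFunction.norm_le (Real.sqrt_nonneg _)).2 fun g => ?_
      refine Real.le_sqrt_of_sq_le ?_
      have h2 : ‖f g‖ ^ 2 ≤ ‖f‖ ^ 2 :=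
        pow_le_pow_left₀ (norm_nonneg _) (f.norm_coe_le_norm g) 2
      rw [← Complex.normSq_eq_norm_sq, Complex.normSq_apply] at h2 ⊢
      simp only [BoundedContinuousFunction.coe_sub, BoundedContinuousFunction.coe_smul,
        Pi.sub_apply, BoundedContinuousFunction.coe_one, Pi.one_apply, smul_eq_mul, mul_one,
        Complex.sub_re, Complex.ofReal_re, Complex.sub_im, Complex.ofReal_im, sub_zero]
      nlinarith [mul_nonneg ht.le (hf g)]
    have h2 := (m.le_opNorm (f - (t : ℂ) • (1 : G →ᵇ ℂ))).trans
      ((hm.2 ▸ one_mul _).trans_le h1)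
    rw [map_sub, map_smul, hm.1, smul_eq_mul, mul_one] at h2
    have h3 : |(m f).re - t| ≤ Real.sqrt (‖f‖ ^ 2 + t ^ 2) := by
      refine le_trans ?_ h2
      simpa using Complex.abs_re_le_norm (m f - (t : ℂ))
    rw [← sq_abs]
    calc |(m f).re - t| ^ 2 ≤ Real.sqrt (‖f‖ ^ 2 + t ^ 2) ^ 2 :=
          pow_le_pow_left₀ (abs_nonneg _) h3 2
      _ = _ := Real.sq_sqrt (by positivity)
  by_contra! hneg
  -- `t = (‖f‖² + 1) / |Re (m f)|` is large enough to contradict `key`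
  have ht : 0 < (‖f‖ ^ 2 + 1) / (-(m f).re) := div_pos (by positivity) (by linarith)
  have h := key _ ht
  have h4 : (‖f‖ ^ 2 + 1) / (-(m f).re) * (-(m f).re) = ‖f‖ ^ 2 + 1 :=
    div_mul_cancel₀ _ (by linarith)
  nlinarith [sq_nonneg (m f).re, sq_nonneg ‖f‖]

theorem IsMean.le_re [Semigroup G] [SeparatelyContinuousMul G] {m : (G →ᵇ ℂ) →L[ℂ] ℂ}
    (hm : IsMean m) {f : G →ᵇ ℂ} {c : ℝ} (hf : ∀ g, c ≤ (f g).re) : c ≤ (m f).re := by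
  have h := hm.re_nonneg (f := f - (c : ℂ) • (1 : G →ᵇ ℂ)) fun g => by simpa using hf g
  rw [map_sub, map_smul, hm.1] at h
  simpa using h

theorem IsMean.nonempty [Semigroup G] [SeparatelyContinuousMul G] {m : (G →ᵇ ℂ) →L[ℂ] ℂ}
    (hm : IsMean m) : Nonempty G := by
  by_contra hne
  rw [not_nonempty_iff] at hne
  have : (1 : G →ᵇ ℂ) = 0 := by ext g; exact hne.elim g
  have h1 := hm.1
  rw [this, map_zero] at h1
  exact zero_ne_one h1

end Mean

section OrbitAverage

variable {G X : Type*} [TopologicalSpace G] [NormedAddCommGroup X] [NormedSpace ℂ X]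
  {T : G → X →L[ℂ] X}

/-- The bounded continuous function `g ↦ φ (T g x)`. -/
def orbitFun (hT : ∀ g x, ‖T g x‖ ≤ ‖x‖) (hc : ∀ x, Continuous fun g => T g x)
    (φ : StrongDual ℂ X) (x : X) : G →ᵇ ℂ :=
  BoundedContinuousFunction.ofNormedAddCommGroup (fun g => φ (T g x))
    (φ.continuous.comp (hc x)) (‖φ‖ * ‖x‖)
    fun g => (φ.le_opNorm _).trans (mul_le_mul_of_nonneg_left (hT g x) (norm_nonneg φ))

/-- The functional `x ↦ m (g ↦ φ (T g x))`, an average of `φ` along the dual orbit. -/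
def averageDual (m : (G →ᵇ ℂ) →L[ℂ] ℂ) (hT : ∀ g x, ‖T g x‖ ≤ ‖x‖)
    (hc : ∀ x, Continuous fun g => T g x) (φ : StrongDual ℂ X) : StrongDual ℂ X :=
  LinearMap.mkContinuous
    { toFun := fun x => m (orbitFun hT hc φ x)
      map_add' := fun x y => by
        rw [← map_add]
        congr 1
        ext g
        simp [orbitFun]
      map_smul' := fun c x => by
        rw [RingHom.id_apply, ← map_smul]
        congr 1
        ext g
        simp [orbitFun] } (‖m‖ * ‖φ‖)
    (fun x => by
      refine (m.le_opNorm _).trans ?_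
      rw [mul_assoc]
      exact mul_le_mul_of_nonneg_left
        (BoundedContinuousFunction.norm_ofNormedAddCommGroup_le _ (by positivity) _)
        (norm_nonneg m))

variable {m : (G →ᵇ ℂ) →L[ℂ] ℂ} (hT : ∀ g x, ‖T g x‖ ≤ ‖x‖)
    (hc : ∀ x, Continuous fun g => T g x)

theorem averageDual_apply (φ : StrongDual ℂ X) (x : X) :
    averageDual m hT hc φ x = m (orbitFun hT hc φ x) := rfl

theorem averageDual_apply_apply [Semigroup G] [SeparatelyContinuousMul G]
    (hinv : ∀ (g : G) (f : G →ᵇ ℂ), m (translate g f) = m f)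
    (hmul : ∀ g h x, T (g * h) x = T h (T g x)) (φ : StrongDual ℂ X) (g : G) (x : X) :
    averageDual m hT hc φ (T g x) = averageDual m hT hc φ x := by
  rw [averageDual_apply, averageDual_apply, ← hinv g (orbitFun hT hc φ x)]
  congr 1
  ext h
  exact congrArg φ (hmul g h x).symm

theorem averageDual_of_mem_fixedSpace (hm1 : m 1 = 1) (φ : StrongDual ℂ X) {x : X}
    (hx : x ∈ fixedSpace T) : averageDual m hT hc φ x = φ x := by
  have : orbitFun hT hc φ x = φ x • (1 : G →ᵇ ℂ) := by
    ext g
    simp [orbitFun, hx g]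
  rw [averageDual_apply, this, map_smul, hm1, smul_eq_mul, mul_one]

/-- Averaging functionals is constant on closed convex hulls of orbits, and fixes the values at
fixed vectors: a fixed vector in the closed convex hull of an orbit is a weak average. -/
theorem apply_eq_averageDual_of_mem_closure [Semigroup G] [SeparatelyContinuousMul G]
    (hm1 : m 1 = 1) (hinv : ∀ (g : G) (f : G →ᵇ ℂ), m (translate g f) = m f)
    (hmul : ∀ g h x, T (g * h) x = T h (T g x)) {x y : X} (hy : y ∈ fixedSpace T)
    (hxy : y ∈ closure (convexHull ℝ (range fun g => T g x))) (φ : StrongDual ℂ X) :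
    φ y = averageDual m hT hc φ x := by
  rw [← averageDual_of_mem_fixedSpace hT hc hm1 φ hy]
  set ψ := averageDual m hT hc φ
  have : closure (convexHull ℝ (range fun g => T g x)) ⊆ ψ ⁻¹' {ψ x} :=
    closure_minimal (convexHull_min
      (by rintro _ ⟨g, rfl⟩; exact averageDual_apply_apply hT hc hinv hmul φ g x)
      ((convex_singleton (ψ x)).linear_preimage (ψ.toLinearMap.restrictScalars ℝ)))
      (isClosed_singleton.preimage ψ.continuous)
  exact this hxy

/-- A weak average of an orbit lies in its closed convex hull, by Hahn–Banach and positivity of the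
mean. -/
theorem mem_closure_of_apply_eq_averageDual [Semigroup G] [SeparatelyContinuousMul G]
    (hm : IsMean m) {x y : X} (hxy : ∀ φ : StrongDual ℂ X, φ y = averageDual m hT hc φ x) :
    y ∈ closure (convexHull ℝ (range fun g => T g x)) := by
  by_contra hy
  obtain ⟨φ, u, hu, h⟩ := RCLike.geometric_hahn_banach_point_closed (𝕜 := ℂ)
    (convex_convexHull ℝ (range fun g => T g x)).closure isClosed_closure hy
  have h1 : u ≤ (m (orbitFun hT hc φ x)).re :=
    hm.le_re fun g => (h _ (subset_closure (subset_convexHull ℝ _ ⟨g, rfl⟩))).le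
  rw [← averageDual_apply, ← hxy φ] at h1
  exact absurd hu (not_lt.2 h1)

/-- The vectors whose orbit has a fixed weak average. -/
def averagingSubmodule (m : (G →ᵇ ℂ) →L[ℂ] ℂ) : Submodule ℂ X where
  carrier := {x | ∃ y ∈ fixedSpace T, ∀ φ : StrongDual ℂ X, φ y = averageDual m hT hc φ x}
  add_mem' := by
    rintro a b ⟨a', ha', ha⟩ ⟨b', hb', hb⟩
    exact ⟨a' + b', add_mem ha' hb', fun φ => by rw [map_add, map_add, ha, hb]⟩
  zero_mem' := ⟨0, zero_mem _, fun φ => by rw [map_zero, map_zero]⟩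
  smul_mem' := by
    rintro c a ⟨a', ha', ha⟩
    exact ⟨c • a', Submodule.smul_mem _ c ha', fun φ => by rw [map_smul, map_smul, ha]⟩

theorem norm_le_of_apply_eq_averageDual [Semigroup G] [SeparatelyContinuousMul G]
    (hm : IsMean m) {x y : X} (hxy : ∀ φ : StrongDual ℂ X, φ y = averageDual m hT hc φ x) :
    ‖y‖ ≤ ‖x‖ := by
  refine NormedSpace.norm_le_dual_bound ℂ y (norm_nonneg x) fun φ => ?_
  rw [hxy φ]
  refine (ContinuousLinearMap.le_of_opNorm_le _
    (LinearMap.mkContinuous_norm_le _ (by positivity) _) x).trans ?_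
  rw [hm.2, one_mul, mul_comm]

theorem isClosed_averagingSubmodule [CompleteSpace X] [Semigroup G] [SeparatelyContinuousMul G]
    (hm : IsMean m) : IsClosed (averagingSubmodule hT hc m : Set X) := by
  rw [← isSeqClosed_iff_isClosed]
  intro u x hu hx
  choose v hvfix hv using hu
  -- averages depend on the vector in a nonexpansive way
  have hdist : ∀ i j, dist (v i) (v j) ≤ dist (u i) (u j) := fun i j => by
    rw [dist_eq_norm, dist_eq_norm]
    exact norm_le_of_apply_eq_averageDual hT hc hm fun φ => by rw [map_sub, map_sub, hv, hv]
  have hcau : CauchySeq v := by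
    have := hx.cauchySeq
    rw [Metric.cauchySeq_iff] at this ⊢
    intro ε hε
    obtain ⟨N, hN⟩ := this ε hε
    exact ⟨N, fun i hi j hj => (hdist i j).trans_lt (hN i hi j hj)⟩
  obtain ⟨y, hy⟩ := cauchySeq_tendsto_of_complete hcau
  refine ⟨y, fun g => ?_, fun φ => ?_⟩
  · refine tendsto_nhds_unique (((T g).continuous.tendsto y).comp hy) ?_
    have : (T g ∘ v) = v := funext fun i => hvfix i g
    rwa [this]
  · refine tendsto_nhds_unique ((φ.continuous.tendsto y).comp hy) ?_
    have : (φ ∘ v) = averageDual m hT hc φ ∘ u := funext fun i => hv i φ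
    rw [this]
    exact ((averageDual m hT hc φ).continuous.tendsto x).comp hx

/-- A contraction semigroup satisfying the amenability condition is mean ergodic as soon as the
closed convex hulls of the orbits of a total set of vectors contain fixed vectors. -/
theorem isMeanErgodic_of_dense_span [CompleteSpace X] [Semigroup G] [SeparatelyContinuousMul G]
    (hG : KoopmanRightAmenable G) (hT : ∀ g x, ‖T g x‖ ≤ ‖x‖)
    (hc : ∀ x, Continuous fun g => T g x) (hmul : ∀ g h x, T (g * h) x = T h (T g x))
    {D : Set X} (hD : Dense (Submodule.span ℂ D : Set X))
    (h : ∀ x ∈ D, ∃ y ∈ fixedSpace T, y ∈ closure (convexHull ℝ (range fun g => T g x))) :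
    IsMeanErgodic T := by
  obtain ⟨m, hm, hinv⟩ := hG
  have htop : ∀ x, x ∈ averagingSubmodule hT hc m := by
    have h1 : Submodule.span ℂ D ≤ averagingSubmodule hT hc m := Submodule.span_le.2 fun x hx => by
      obtain ⟨y, hy, hxy⟩ := h x hx
      exact ⟨y, hy, apply_eq_averageDual_of_mem_closure hT hc hm.1 hinv hmul hy hxy⟩
    exact fun x => closure_minimal h1 (isClosed_averagingSubmodule hT hc hm) (hD x)
  choose p hpfix hp using htop
  have huniq : ∀ {y z : X}, (∀ φ : StrongDual ℂ X, φ y = φ z) → y = z :=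
    fun h => (SeparatingDual.eq_iff_forall_dual_eq (R := ℂ)).2 h
  let P : X →L[ℂ] X := LinearMap.mkContinuous
    { toFun := p
      map_add' := fun x y => huniq fun φ => by rw [map_add, hp, hp, hp, map_add]
      map_smul' := fun c x => huniq fun φ => by rw [RingHom.id_apply, map_smul, hp, hp, map_smul] }
    1 fun x => by rw [one_mul]; exact norm_le_of_apply_eq_averageDual hT hc hm (hp x)
  have hPp : ∀ x, P x = p x := fun x => rfl
  have hPT : ∀ g x, P (T g x) = P x := fun g x => huniq fun φ => by
    rw [hPp, hPp, hp, hp, averageDual_apply_apply hT hc hinv hmul]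
  have hPB : ∀ B ∈ convexHull ℝ (range T), ∀ x, P (B x) = P x := fun B hB x =>
    comp_eq_of_mem_sotClosure hPT (subset_sotClosure hB) x
  have hPfix : ∀ x, P x ∈ fixedSpace T := hpfix
  refine ⟨P, mem_sotClosure_iff.2 fun s hs ε hε => ?_, fun Q hQ => ⟨?_, ?_⟩⟩
  · -- the vectors are treated one after another: later convex combinations preserve earlier estimates
    induction s, hs using Set.Finite.induction_on with
    | empty =>
      obtain ⟨g⟩ := hm.nonempty
      exact ⟨T g, subset_convexHull ℝ _ ⟨g, rfl⟩, by simp⟩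
    | @insert x s _ _ ih =>
      obtain ⟨B, hB, hBs⟩ := ih
      have hmem := mem_closure_of_apply_eq_averageDual hT hc hm (hp (B x))
      rw [← image_eval_convexHull] at hmem
      obtain ⟨_, ⟨A, hA, rfl⟩, hAx⟩ := Metric.mem_closure_iff.1 hmem ε hε
      refine ⟨A ∘L B, comp_mem_convexHull hmul hA hB, ?_⟩
      rintro z (rfl | hz)
      · rw [← hPp, hPB B hB z, dist_comm, dist_eq_norm] at hAx
        exact hAx
      · have h1 : A (P z) = P z := apply_eq_of_mem_fixedSpace (hPfix z) (subset_sotClosure hA)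
        have h2 : (A ∘L B) z - P z = A (B z - P z) := by rw [map_sub, h1]; rfl
        rw [h2]
        exact (norm_apply_le_of_mem_convexHull hT hA _).trans_lt (hBs z hz)
  · ext x
    exact comp_eq_of_mem_sotClosure hPT hQ x
  · ext x
    exact apply_eq_of_mem_fixedSpace (hPfix x) hQ

end OrbitAverage

/-! ### Unique ergodicity -/

section Curry

variable {G Y E : Type*} [TopologicalSpace G] [TopologicalSpace Y]
  [NormedAddCommGroup E]

/-- A jointly continuous family of functions on a compact space is norm continuous in its
parameter. -/
theorem continuous_of_continuous_uncurry {F : G → C(Y, E)}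
    (hF : Continuous fun p : G × Y => F p.1 p.2) : Continuous F :=
  (ContinuousMap.curry ⟨fun p : G × Y => F p.1 p.2, hF⟩).continuous

end Curry

section UniquelyErgodic

variable {G K : Type*} [Semigroup G] [TopologicalSpace G] [TopologicalSpace K] [SemigroupAction G K]
  [ContinuousSMul G K]

/-- The translate `x ↦ u (g x)` of a continuous function on `K`. -/
def translateC (g : G) (u : C(K, ℝ)) : C(K, ℝ) := u.comp ⟨fun x => g • x, continuous_const_smul g⟩

theorem continuous_translateC (u : C(K, ℝ)) : Continuous fun g : G => translateC g u :=
  continuous_of_continuous_uncurry (u.continuous.comp continuous_smul)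

variable [CompactSpace K]

/-- The bounded continuous function `g ↦ Λ (u (g ·))` on `G`. -/
def orbitFunReal (Λ : StrongDual ℝ C(K, ℝ)) (u : C(K, ℝ)) : G →ᵇ ℂ :=
  BoundedContinuousFunction.ofNormedAddCommGroup (fun g => ((Λ (translateC g u) : ℝ) : ℂ))
    (Complex.continuous_ofReal.comp (Λ.continuous.comp (continuous_translateC u))) (‖Λ‖ * ‖u‖)
    fun g => by
      rw [Complex.norm_real]
      refine (Λ.le_opNorm _).trans (mul_le_mul_of_nonneg_left ?_ (norm_nonneg Λ))
      exact (ContinuousMap.norm_le _ (norm_nonneg u)).2 fun x => u.norm_coe_le_norm (g • x)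

/-- The average of a real functional on `C(K)` along its dual orbit. -/
def averageReal (m : (G →ᵇ ℂ) →L[ℂ] ℂ) (Λ : StrongDual ℝ C(K, ℝ)) : C(K, ℝ) →ₗ[ℝ] ℝ where
  toFun u := (m (orbitFunReal Λ u)).re
  map_add' u v := by
    rw [← Complex.add_re, ← map_add]
    congr 2
    ext g
    have : translateC g (u + v) = translateC g u + translateC g v := rfl
    simp [orbitFunReal, this]
  map_smul' c u := by
    have h : orbitFunReal (G := G) Λ (c • u) = (c : ℂ) • orbitFunReal Λ u := by
      ext g
      have : translateC g (c • u) = c • translateC g u := rfl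
      simp [orbitFunReal, this]
    rw [h, map_smul, smul_eq_mul, Complex.re_ofReal_mul]
    rfl

variable [T2Space K] [MeasurableSpace K] [BorelSpace K]

/-- By the Riesz–Markov–Kakutani theorem an invariant state of `C(K)` is a regular invariant
probability measure, hence integration against the only one. -/
theorem eq_integral_of_invariant (hK : IsUniquelyErgodic G K)
    (μ : Measure K) [IsProbabilityMeasure μ] [μ.Regular] [SMulInvariantMeasure G K μ]
    (Λ : C(K, ℝ) →ₗ[ℝ] ℝ) (hpos : ∀ u : C(K, ℝ), 0 ≤ u → 0 ≤ Λ u) (h1 : Λ 1 = 1)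
    (hinv : ∀ (g : G) (u : C(K, ℝ)), Λ (translateC g u) = Λ u)
    (u : C(K, ℝ)) : Λ u = ∫ x, u x ∂μ := by
  let Λ' : CompactlySupportedContinuousMap K ℝ →ₚ[ℝ] ℝ :=
    { toFun := fun f => Λ f.toContinuousMap
      map_add' := fun f f' => Λ.map_add f.toContinuousMap f'.toContinuousMap
      map_smul' := fun c f => Λ.map_smul c f.toContinuousMap
      monotone' := fun f f' hff => by
        have := hpos (f'.toContinuousMap - f.toContinuousMap)
          (fun x => sub_nonneg.2 (hff x))
        rw [map_sub] at this
        exact sub_nonneg.1 this }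
  set ν := RealRMK.rieszMeasure Λ' with hν
  have hint : ∀ v : C(K, ℝ), ∫ x, v x ∂ν = Λ v := fun v =>
    RealRMK.integral_rieszMeasure Λ' ⟨v, HasCompactSupport.of_compactSpace _⟩
  have hreg : ν.Regular := inferInstance
  have hfin : IsFiniteMeasure ν := inferInstance
  have hprob : IsProbabilityMeasure ν := by
    constructor
    have h := hint 1
    rw [h1] at h
    simp only [ContinuousMap.one_apply, integral_const, smul_eq_mul, mul_one, Measure.real] at h
    exact (ENNReal.toReal_eq_one_iff _).1 h
  have hsm : SMulInvariantMeasure G K ν := by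
    constructor
    intro g s hs
    have hg : Continuous fun x : K => g • x := continuous_const_smul g
    have hreg' : (ν.map fun x => g • x).Regular := by
      have : (ν.map fun x => g • x).InnerRegularCompactLTTop :=
        Measure.InnerRegularCompactLTTop.map_of_continuous hg
      infer_instance
    have : (ν.map fun x => g • x) = ν :=
      Measure.ext_of_integral_eq_on_compactlySupported fun f => by
        refine (integral_map hg.aemeasurable f.continuous.aestronglyMeasurable).trans ?_
        exact (hint (f.toContinuousMap.comp ⟨fun x => g • x, hg⟩)).trans
          ((hinv g f.toContinuousMap).trans (hint f.toContinuousMap).symm)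
    rw [← Measure.map_apply hg.measurable hs, this]
  have : ν = μ := hK.unique ⟨hprob, hreg, hsm⟩ ⟨inferInstance, inferInstance, inferInstance⟩
  rw [← hint u, this]

variable [SeparatelyContinuousMul G] {μ : Measure K} [IsProbabilityMeasure μ] [μ.Regular]
  [SMulInvariantMeasure G K μ]

/-- The average of a state of `C(K)` along its dual orbit is an invariant state, hence equal to
integration against the unique invariant measure. -/
theorem averageReal_eq_integral (hK : IsUniquelyErgodic G K) {m : (G →ᵇ ℂ) →L[ℂ] ℂ}
    (hm : IsMean m) (hinv : ∀ (g : G) (f : G →ᵇ ℂ), m (translate g f) = m f)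
    {Λ : StrongDual ℝ C(K, ℝ)} (hpos : ∀ u : C(K, ℝ), 0 ≤ u → 0 ≤ Λ u) (h1 : Λ 1 = 1)
    (u : C(K, ℝ)) : (m (orbitFunReal Λ u)).re = ∫ x, u x ∂μ := by
  refine eq_integral_of_invariant hK μ (averageReal m Λ) (fun v hv => ?_) ?_ (fun g v => ?_) u
  · exact hm.re_nonneg fun g => by
      simpa [orbitFunReal] using hpos (translateC g v) (fun x => hv (g • x))
  · have : orbitFunReal (G := G) Λ (1 : C(K, ℝ)) = 1 := by
      ext g
      have : translateC g (1 : C(K, ℝ)) = 1 := rfl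
      simp [orbitFunReal, this, h1]
    change (m (orbitFunReal Λ 1)).re = 1
    rw [this, hm.1, Complex.one_re]
  · change (m (orbitFunReal Λ _)).re = (m (orbitFunReal Λ v)).re
    rw [← hinv g (orbitFunReal Λ v)]
    congr 2
    ext h
    have : translateC h (translateC g v) = translateC (g * h) v := by
      ext x
      simp [translateC, mul_smul]
    change ((Λ (translateC h (translateC g v)) : ℝ) : ℂ) = _
    rw [this]
    rfl

/-- Under unique ergodicity, invariant continuous functions are constant. -/
theorem eq_integral_of_forall_smul (hG : KoopmanRightAmenable G) (hK : IsUniquelyErgodic G K)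
    (u : C(K, ℝ)) (hu : ∀ (g : G) x, u (g • x) = u x) (x : K) : u x = ∫ y, u y ∂μ := by
  obtain ⟨m, hm, hinv⟩ := hG
  rw [← averageReal_eq_integral hK hm hinv (Λ := ContinuousMap.evalCLM ℝ x)
    (fun v hv => hv x) rfl u]
  have : orbitFunReal (G := G) (ContinuousMap.evalCLM ℝ x) u = ((u x : ℝ) : ℂ) • (1 : G →ᵇ ℂ) := by
    ext g
    have : translateC g u x = u x := hu g x
    simp [orbitFunReal, this]
  rw [this, map_smul, hm.1, smul_eq_mul, mul_one, Complex.ofReal_re]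

/-- Under unique ergodicity, convex combinations of the translates of `u` are uniformly at most
`∫ u + ε`: a functional separating them from the open set of functions `< ∫ u + ε` would be
positive, and its average would not be integration against `μ`. -/
theorem exists_mem_convexHull_lt (hG : KoopmanRightAmenable G) (hK : IsUniquelyErgodic G K)
    (u : C(K, ℝ)) {ε : ℝ} (hε : 0 < ε) :
    ∃ v ∈ convexHull ℝ (range fun g : G => translateC g u), ∀ x, v x < ∫ y, u y ∂μ + ε := by
  obtain ⟨m, hm, hinv⟩ := hG
  by_contra! hcon
  set c := ∫ y, u y ∂μ with hc
  let S : Set C(K, ℝ) := {w | ∀ x, w x < c + ε}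
  have hSo : IsOpen S := by
    have : S = {w : C(K, ℝ) | MapsTo w univ (Iio (c + ε))} := by
      ext w
      simp [S, MapsTo]
    rw [this]
    exact ContinuousMap.isOpen_setOfPred_mapsTo isCompact_univ isOpen_Iio
  have hSc : Convex ℝ S := by
    intro w hw w' hw' a b ha hb hab x
    have := (convex_Iio (c + ε)) (hw x) (hw' x) ha hb hab
    exact this
  have hdisj : Disjoint S (convexHull ℝ (range fun g : G => translateC g u)) := by
    rw [disjoint_left]
    intro w hw hw'
    obtain ⟨x, hx⟩ := hcon w hw'
    exact absurd (hw x) (not_lt.2 hx)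
  obtain ⟨φ, s, hφS, hφ⟩ := geometric_hahn_banach_open hSc hSo (convex_convexHull ℝ _) hdisj
  have hφg : ∀ g : G, s ≤ φ (translateC g u) := fun g => hφ _ (subset_convexHull ℝ _ ⟨g, rfl⟩)
  have hpos : ∀ v : C(K, ℝ), 0 ≤ v → 0 ≤ φ v := by
    intro v hv
    by_contra! hneg
    -- `φ` is bounded above on the ray `c - t v`, `t ≥ 0`, which lies in `S`
    have hray : ∀ t : ℝ, 0 ≤ t → c * φ 1 - t * φ v < s := by
      intro t ht
      have hmem : c • (1 : C(K, ℝ)) - t • v ∈ S := fun x => by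
        have : 0 ≤ t * v x := mul_nonneg ht (hv x)
        simp only [ContinuousMap.sub_apply, ContinuousMap.smul_apply, ContinuousMap.one_apply,
          smul_eq_mul, mul_one]
        linarith
      have := hφS _ hmem
      rwa [map_sub, map_smul, map_smul, smul_eq_mul, smul_eq_mul] at this
    have h := hray (|s - c * φ 1| / (-φ v)) (div_nonneg (abs_nonneg _) (by linarith))
    have h2 : |s - c * φ 1| / (-φ v) * φ v = -|s - c * φ 1| := by
      rw [div_neg, neg_mul, div_mul_cancel₀ _ hneg.ne]
    rw [h2] at h
    linarith [le_abs_self (s - c * φ 1)]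
  -- if `φ 1 = 0` then `φ = 0`, which cannot separate
  have hφ1 : 0 < φ 1 := by
    refine lt_of_le_of_ne (hpos 1 fun x => zero_le_one) fun h0 => ?_
    have hbound : ∀ v : C(K, ℝ), φ v ≤ 0 := fun v => by
      have := hpos (‖v‖ • (1 : C(K, ℝ)) - v) fun x => by
        simpa using (le_abs_self _).trans (v.norm_coe_le_norm x)
      rw [map_sub, map_smul, ← h0, smul_zero, zero_sub] at this
      linarith
    have hs : 0 < s := by
      have hmem : (c + ε / 2) • (1 : C(K, ℝ)) ∈ S := fun x => by
        simp only [ContinuousMap.smul_apply, ContinuousMap.one_apply, smul_eq_mul, mul_one]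
        linarith
      have := hφS _ hmem
      rwa [map_smul, ← h0, smul_zero] at this
    obtain ⟨g⟩ := hm.nonempty
    linarith [hφg g, hbound (translateC g u)]
  let Λ : StrongDual ℝ C(K, ℝ) := (φ 1)⁻¹ • φ
  have hΛ := averageReal_eq_integral (μ := μ) hK hm hinv (Λ := Λ)
    (fun v hv => mul_nonneg (inv_nonneg.2 hφ1.le) (hpos v hv)) (inv_mul_cancel₀ hφ1.ne') u
  have h2 : (φ 1)⁻¹ * s ≤ (m (orbitFunReal Λ u)).re := hm.le_re fun g => by
    change (φ 1)⁻¹ * s ≤ (((φ 1)⁻¹ * φ (translateC g u) : ℝ) : ℂ).re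
    rw [Complex.ofReal_re]
    exact mul_le_mul_of_nonneg_left (hφg g) (inv_nonneg.2 hφ1.le)
  have h3 : (c + ε / 2) * φ 1 < s := by
    have hmem : (c + ε / 2) • (1 : C(K, ℝ)) ∈ S := fun x => by
      simp only [ContinuousMap.smul_apply, ContinuousMap.one_apply, smul_eq_mul, mul_one]
      linarith
    have := hφS _ hmem
    rwa [map_smul, smul_eq_mul] at this
  rw [hΛ, ← hc, inv_mul_le_iff₀ hφ1] at h2
  nlinarith

end UniquelyErgodic

/-! ### Fixed vectors of contraction semigroups on Hilbert spaces -/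

/-- The element of minimal norm in the closed convex hull of an orbit of a contraction semigroup on
a Hilbert space is fixed. -/
theorem exists_fixed_mem_closure_convexHull {G H : Type*} [Semigroup G] [Nonempty G]
    [NormedAddCommGroup H] [InnerProductSpace ℂ H] [CompleteSpace H] {T : G → H →L[ℂ] H}
    (hT : ∀ g x, ‖T g x‖ ≤ ‖x‖) (hmul : ∀ g h x, T (g * h) x = T h (T g x)) (x : H) :
    ∃ y ∈ fixedSpace T, y ∈ closure (convexHull ℝ (range fun g => T g x)) := by
  let _ : InnerProductSpace ℝ H := InnerProductSpace.rclikeToReal ℂ H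
  set C := closure (convexHull ℝ (range fun g => T g x)) with hC
  have hconv : Convex ℝ C := (convex_convexHull ℝ _).closure
  have hne : C.Nonempty := ((range_nonempty _).convexHull).closure
  have hinv : ∀ g, ∀ z ∈ C, T g z ∈ C := by
    intro g z hz
    have h1 := map_mem_closure_convexHull (T g) hz
    refine closure_mono (convexHull_mono ?_) h1
    rintro _ ⟨h, rfl⟩
    exact ⟨h * g, hmul h g x⟩
  obtain ⟨y, hy, hmin⟩ :=
    exists_norm_eq_iInf_of_complete_convex hne isClosed_closure.isComplete hconv (0 : H)
  rw [norm_eq_iInf_iff_real_inner_le_zero hconv hy] at hmin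
  refine ⟨y, fun g => ?_, hy⟩
  have h1 := hmin (T g y) (hinv g y hy)
  rw [zero_sub, inner_neg_left, inner_sub_right, real_inner_self_eq_norm_sq] at h1
  have h2 : ‖T g y - y‖ ^ 2 ≤ 0 := by
    rw [norm_sub_sq_real, real_inner_comm]
    have := pow_le_pow_left₀ (norm_nonneg _) (hT g y) 2
    linarith
  have h3 : ‖T g y - y‖ = 0 := pow_eq_zero_iff two_ne_zero |>.1 (le_antisymm h2 (by positivity))
  exact sub_eq_zero.1 (norm_eq_zero.1 h3)

/-! ### The operators `γ(g, ·) S_g` -/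

section Weighted

variable {G K : Type*} [Semigroup G] [TopologicalSpace G] [TopologicalSpace K]
  [SemigroupAction G K] [ContinuousSMul G K] {N : ℕ}

section L2

variable [MeasurableSpace K] [BorelSpace K] {μ : Measure K} [SMulInvariantMeasure G K μ]

theorem norm_koopmanL2_le (γ : ContinuousCocycle G K (UN N)) (g : G) (f : Lp (CN N) 2 μ) :
    ‖koopmanL2 μ γ g f‖ ≤ ‖f‖ := by
  refine (ContinuousLinearMap.le_of_opNorm_le _
    (LinearMap.mkContinuous_norm_le _ zero_le_one _) f).trans_eq (one_mul _)

theorem koopmanL2_mul (γ : ContinuousCocycle G K (UN N)) (g h : G) (f : Lp (CN N) 2 μ) :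
    koopmanL2 μ γ (g * h) f = koopmanL2 μ γ h (koopmanL2 μ γ g f) := by
  refine Lp.ext ((koopmanL2_coeFn γ (g * h) f).trans ?_)
  refine Filter.EventuallyEq.trans (.of_forall fun x => ?_)
    ((koopmanL2_coeFn γ h _).trans (twist_congr_ae γ h (koopmanL2_coeFn γ g f))).symm
  simp [twist, γ.map_mul, mul_smul]

end L2

variable [CompactSpace K]

theorem koopmanC_apply (γ : ContinuousCocycle G K (UN N)) (g : G) (f : C(K, CN N)) (x : K) :
    koopmanC γ g f x = (γ.toFun g x : CN N →L[ℂ] CN N) (f (g • x)) := rfl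

theorem norm_koopmanC_apply (γ : ContinuousCocycle G K (UN N)) (g : G) (f : C(K, CN N)) (x : K) :
    ‖koopmanC γ g f x‖ = ‖f (g • x)‖ := norm_twist γ g f x

/-- The continuous function `x ↦ ‖f x‖²`. -/
def normSqC (f : C(K, CN N)) : C(K, ℝ) := ⟨fun x => ‖f x‖ ^ 2, f.continuous.norm.pow 2⟩

theorem koopmanC_mul (γ : ContinuousCocycle G K (UN N)) (g h : G) (f : C(K, CN N)) :
    koopmanC γ (g * h) f = koopmanC γ h (koopmanC γ g f) := by
  ext1 x
  simp [koopmanC_apply, γ.map_mul, mul_smul]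

/-- A convex combination of translates of `‖v‖²` dominates `‖A v‖²`, for the corresponding convex
combination `A` of the operators `γ(g, ·) S_g`. -/
theorem exists_normSq_le_of_mem_convexHull (γ : ContinuousCocycle G K (UN N)) (v : C(K, CN N))
    {w : C(K, ℝ)} (hw : w ∈ convexHull ℝ (range fun g : G => translateC g (normSqC v))) :
    ∃ A ∈ convexHull ℝ (range (koopmanC γ)), ∀ x, ‖A v x‖ ^ 2 ≤ w x := by
  let S : Set C(K, ℝ) := {w | ∃ A ∈ convexHull ℝ (range (koopmanC γ)), ∀ x, ‖A v x‖ ^ 2 ≤ w x}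
  suffices convexHull ℝ (range fun g : G => translateC g (normSqC v)) ⊆ S from this hw
  refine convexHull_min ?_ ?_
  · rintro _ ⟨g, rfl⟩
    refine ⟨koopmanC γ g, subset_convexHull ℝ _ ⟨g, rfl⟩, fun x => ?_⟩
    rw [norm_koopmanC_apply]
    rfl
  · rintro w₁ ⟨A₁, hA₁, h₁⟩ w₂ ⟨A₂, hA₂, h₂⟩ a b ha hb hab
    refine ⟨a • A₁ + b • A₂, convex_convexHull ℝ _ hA₁ hA₂ ha hb hab, fun x => ?_⟩
    have h3 : (a • A₁ + b • A₂) v x = a • (A₁ v x) + b • (A₂ v x) := rfl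
    have h4 : ‖a • (A₁ v x) + b • (A₂ v x)‖ ≤ a * ‖A₁ v x‖ + b * ‖A₂ v x‖ := by
      refine (norm_add_le _ _).trans_eq ?_
      rw [norm_smul, norm_smul, Real.norm_of_nonneg ha, Real.norm_of_nonneg hb]
    have h5 := (convexOn_pow (𝕜 := ℝ) 2).2 (norm_nonneg (A₁ v x)) (norm_nonneg (A₂ v x)) ha hb hab
    simp only [smul_eq_mul] at h5
    calc ‖(a • A₁ + b • A₂) v x‖ ^ 2 ≤ (a * ‖A₁ v x‖ + b * ‖A₂ v x‖) ^ 2 := by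
          rw [h3]
          exact pow_le_pow_left₀ (norm_nonneg _) h4 2
      _ ≤ a * ‖A₁ v x‖ ^ 2 + b * ‖A₂ v x‖ ^ 2 := h5
      _ ≤ a * w₁ x + b * w₂ x :=
          add_le_add (mul_le_mul_of_nonneg_left (h₁ x) ha) (mul_le_mul_of_nonneg_left (h₂ x) hb)

variable [MeasurableSpace K] [BorelSpace K] {μ : Measure K} [SMulInvariantMeasure G K μ]

theorem norm_toLp_sq [IsFiniteMeasure μ] (f : C(K, CN N)) :
    ‖ContinuousMap.toLp 2 μ ℂ f‖ ^ 2 = ∫ x, ‖f x‖ ^ 2 ∂μ := by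
  rw [← inner_self_eq_norm_sq (𝕜 := ℂ), L2.inner_def]
  have h : ∫ x, inner ℂ (ContinuousMap.toLp 2 μ ℂ f x) (ContinuousMap.toLp 2 μ ℂ f x) ∂μ =
      ∫ x, ((‖f x‖ ^ 2 : ℝ) : ℂ) ∂μ := by
    refine integral_congr_ae ?_
    filter_upwards [ContinuousMap.coeFn_toLp (p := 2) (𝕜 := ℂ) μ f] with x hx
    rw [hx, inner_self_eq_norm_sq_to_K]
    push_cast
    rfl
  rw [h, integral_complex_ofReal]
  exact Complex.ofReal_re _

theorem toLp_mem_closure_convexHull [IsFiniteMeasure μ] (γ : ContinuousCocycle G K (UN N))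
    {f f₀ : C(K, CN N)} (h : f₀ ∈ closure (convexHull ℝ (range fun g => koopmanC γ g f))) :
    ContinuousMap.toLp 2 μ ℂ f₀ ∈
      closure (convexHull ℝ (range fun g => koopmanL2 μ γ g (ContinuousMap.toLp 2 μ ℂ f))) := by
  simp_rw [koopmanL2_toLp]
  exact map_mem_closure_convexHull (ContinuousMap.toLp (E := CN N) 2 μ ℂ) h

variable [SeparatelyContinuousMul G] [T2Space K] [IsProbabilityMeasure μ] [μ.Regular]

/-- Fixed continuous functions have constant norm, under unique ergodicity. -/
theorem norm_apply_eq_norm_toLp (hG : KoopmanRightAmenable G) (hK : IsUniquelyErgodic G K)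
    (γ : ContinuousCocycle G K (UN N)) {f : C(K, CN N)} (hf : f ∈ fixedSpace (koopmanC γ)) (x : K) :
    ‖f x‖ = ‖ContinuousMap.toLp 2 μ ℂ f‖ := by
  have h := eq_integral_of_forall_smul (μ := μ) hG hK (normSqC f) (fun g y => by
    change ‖f (g • y)‖ ^ 2 = ‖f y‖ ^ 2
    rw [← norm_koopmanC_apply γ g f y, hf g]) x
  have h2 : ‖f x‖ ^ 2 = ‖ContinuousMap.toLp 2 μ ℂ f‖ ^ 2 := by
    rw [norm_toLp_sq]
    exact h
  exact (pow_left_inj₀ (norm_nonneg _) (norm_nonneg _) two_ne_zero).1 h2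

/-- The fixed continuous functions form a closed subspace of `L²`. -/
theorem isClosed_map_toLp_fixedSpace (hG : KoopmanRightAmenable G) (hK : IsUniquelyErgodic G K)
    (γ : ContinuousCocycle G K (UN N)) :
    IsClosed ((fixedSpace (koopmanC γ)).map
      (ContinuousMap.toLp (E := CN N) 2 μ ℂ).toLinearMap : Set (Lp (CN N) 2 μ)) := by
  have hclosed : IsClosed (fixedSpace (koopmanC γ) : Set C(K, CN N)) := by
    have : (fixedSpace (koopmanC γ) : Set C(K, CN N)) = ⋂ g, {f | koopmanC γ g f = f} := by
      ext f
      simp only [mem_iInter]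
      rfl
    rw [this]
    exact isClosed_iInter fun g => isClosed_eq (koopmanC γ g).continuous continuous_id
  have : Nonempty K := nonempty_of_isProbabilityMeasure μ
  let ι : fixedSpace (koopmanC γ) →ₗᵢ[ℂ] Lp (CN N) 2 μ :=
    { toLinearMap := (ContinuousMap.toLp (E := CN N) 2 μ ℂ).toLinearMap ∘ₗ
        (fixedSpace (koopmanC γ)).subtype
      norm_map' := fun f => by
        refine le_antisymm ?_ ?_
        · obtain ⟨x⟩ := this
          exact (norm_apply_eq_norm_toLp hG hK γ f.2 x).symm.trans_le (f.1.norm_coe_le_norm x)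
        · exact (ContinuousMap.norm_le _ (norm_nonneg _)).2 fun x =>
            (norm_apply_eq_norm_toLp hG hK γ f.2 x).le }
  have : CompleteSpace (fixedSpace (koopmanC γ)) := hclosed.completeSpace_coe
  have h := ι.isometry.isClosedEmbedding.isClosed_range
  convert h using 1
  ext y
  simp only [Submodule.map_coe, mem_image, mem_range]
  constructor
  · rintro ⟨f, hf, rfl⟩
    exact ⟨⟨f, hf⟩, rfl⟩
  · rintro ⟨f, rfl⟩
    exact ⟨f.1, f.2, rfl⟩

/-- If the closed convex hulls of all orbits in `C(K, ℂ^N)` contain fixed functions, then every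
fixed vector in `L²` is approximated by, hence is, a fixed continuous function. -/
theorem fixedSpace_koopmanL2_le (hG : KoopmanRightAmenable G) (hK : IsUniquelyErgodic G K)
    (γ : ContinuousCocycle G K (UN N))
    (h : ∀ f : C(K, CN N), ∃ f₀ ∈ fixedSpace (koopmanC γ),
      f₀ ∈ closure (convexHull ℝ (range fun g => koopmanC γ g f))) :
    fixedSpace (koopmanL2 μ γ) ≤ (fixedSpace (koopmanC γ)).map
      (ContinuousMap.toLp (E := CN N) 2 μ ℂ).toLinearMap := by
  intro k hk
  have hcl := isClosed_map_toLp_fixedSpace (μ := μ) hG hK γ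
  rw [← SetLike.mem_coe, ← hcl.closure_eq, Metric.mem_closure_iff]
  intro ε hε
  obtain ⟨_, ⟨f, rfl⟩, hf⟩ := Metric.mem_closure_iff.1
    (ContinuousMap.toLp_denseRange (CN N) μ ℂ ENNReal.ofNat_ne_top k) (ε / 2) (half_pos hε)
  obtain ⟨f₀, hf₀, hmem⟩ := h f
  refine ⟨_, ⟨f₀, hf₀, rfl⟩, ?_⟩
  have hsub : closure (convexHull ℝ
      (range fun g => koopmanL2 μ γ g (ContinuousMap.toLp 2 μ ℂ f))) ⊆
      Metric.closedBall k (ε / 2) := by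
    refine closure_minimal (convexHull_min ?_ (convex_closedBall _ _)) Metric.isClosed_closedBall
    rintro _ ⟨g, rfl⟩
    rw [Metric.mem_closedBall, dist_eq_norm]
    nth_rewrite 1 [← hk g]
    rw [← map_sub]
    refine (norm_koopmanL2_le γ g _).trans ?_
    rw [← dist_eq_norm, dist_comm]
    exact hf.le
  have := hsub (toLp_mem_closure_convexHull γ hmem)
  rw [Metric.mem_closedBall, dist_comm] at this
  exact this.trans_lt (half_lt_self hε)

/-- If fixed vectors in `L²` are continuous, then closed convex hulls of orbits in `C(K, ℂ^N)`
contain fixed functions: `L²`-small convex combinations of an orbit become uniformly small after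
a further averaging, by unique ergodicity applied to the square of their norm. -/
theorem exists_fixed_mem_closure_koopmanC (hG : KoopmanRightAmenable G)
    (hK : IsUniquelyErgodic G K) (γ : ContinuousCocycle G K (UN N))
    (h : fixedSpace (koopmanL2 μ γ) ≤ (fixedSpace (koopmanC γ)).map
      (ContinuousMap.toLp (E := CN N) 2 μ ℂ).toLinearMap) (f : C(K, CN N)) :
    ∃ f₀ ∈ fixedSpace (koopmanC γ),
      f₀ ∈ closure (convexHull ℝ (range fun g => koopmanC γ g f)) := by
  have hne : Nonempty G := hG.choose_spec.1.nonempty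
  obtain ⟨k, hk, hkmem⟩ := exists_fixed_mem_closure_convexHull (T := koopmanL2 μ γ)
    (norm_koopmanL2_le γ) (koopmanL2_mul γ) (ContinuousMap.toLp 2 μ ℂ f)
  obtain ⟨f₀, hf₀, rfl⟩ := h hk
  refine ⟨f₀, hf₀, ?_⟩
  rw [← image_eval_convexHull, Metric.mem_closure_iff]
  intro ε hε
  have hδ : 0 < ε ^ 2 / 2 := by positivity
  simp_rw [koopmanL2_toLp] at hkmem
  have himg := ((ContinuousMap.toLp (E := CN N) 2 μ ℂ).toLinearMap.restrictScalars
    ℝ).image_convexHull (range fun g => koopmanC γ g f)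
  rw [← range_comp, ← image_eval_convexHull] at himg
  have hkmem' : ContinuousMap.toLp 2 μ ℂ f₀ ∈ closure
      (convexHull ℝ (range fun g => ContinuousMap.toLp 2 μ ℂ (koopmanC γ g f))) := hkmem
  obtain ⟨b, hb, hbd⟩ := Metric.mem_closure_iff.1 hkmem' _ (Real.sqrt_pos.2 hδ)
  obtain ⟨_, ⟨B, hB, rfl⟩, rfl⟩ := himg.symm.subset hb
  have hsmall : ∫ x, normSqC (B f - f₀) x ∂μ < ε ^ 2 / 2 := by
    have h1 : ‖ContinuousMap.toLp (E := CN N) 2 μ ℂ (B f - f₀)‖ < Real.sqrt (ε ^ 2 / 2) := by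
      rw [map_sub, ← dist_eq_norm, dist_comm]
      exact hbd
    calc ∫ x, normSqC (B f - f₀) x ∂μ = ‖ContinuousMap.toLp (E := CN N) 2 μ ℂ (B f - f₀)‖ ^ 2 :=
          (norm_toLp_sq _).symm
      _ < Real.sqrt (ε ^ 2 / 2) ^ 2 := pow_lt_pow_left₀ h1 (norm_nonneg _) two_ne_zero
      _ = ε ^ 2 / 2 := Real.sq_sqrt hδ.le
  obtain ⟨w, hw, hwlt⟩ := exists_mem_convexHull_lt (μ := μ) hG hK (normSqC (B f - f₀)) hδ
  obtain ⟨A, hA, hAw⟩ := exists_normSq_le_of_mem_convexHull γ (B f - f₀) hw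
  refine ⟨(A ∘L B) f, ⟨A ∘L B, comp_mem_convexHull (koopmanC_mul γ) hA hB, rfl⟩, ?_⟩
  have hAf₀ : A f₀ = f₀ := apply_eq_of_mem_fixedSpace hf₀ (subset_sotClosure hA)
  have hdiff : (A ∘L B) f - f₀ = A (B f - f₀) := by
    rw [map_sub, hAf₀]
    rfl
  rw [dist_comm, dist_eq_norm, hdiff, ContinuousMap.norm_lt_iff _ hε]
  intro x
  have h1 : ‖A (B f - f₀) x‖ ^ 2 < ε ^ 2 := by
    refine (hAw x).trans_lt ((hwlt x).trans ?_)
    linarith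
  exact lt_of_pow_lt_pow_left₀ 2 hε.le h1

end Weighted

/-! ### The skew product Koopman semigroup and its coordinates along representations -/

section Skew

variable {G K Ω : Type*} [Semigroup G] [TopologicalSpace G] [TopologicalSpace K]
  [CompactSpace K] [SemigroupAction G K] [ContinuousSMul G K]
  [Group Ω] [TopologicalSpace Ω] [CompactSpace Ω]

variable {N : ℕ}

/-- The coordinate map `f ↦ ((x, ω) ↦ ⟪v, π(ω) f(x)⟫)` from `C(K, ℂ^N)` to `C(K × Ω)`. -/
def coordMap (K : Type*) [TopologicalSpace K] [CompactSpace K] (π : Ω →ₜ* UN N) (v : CN N) :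
    C(K, CN N) →L[ℂ] C(K × Ω, ℂ) :=
  LinearMap.mkContinuous
    { toFun := fun f => ⟨fun p => inner ℂ v ((π p.2 : CN N →L[ℂ] CN N) (f p.1)), by
        refine continuous_const.inner (Continuous.clm_apply ?_ (f.continuous.comp continuous_fst))
        exact continuous_subtype_val.comp (π.continuous_toFun.comp continuous_snd)⟩
      map_add' := fun f f' => by ext p; simp
      map_smul' := fun c f => by ext p; simp } ‖v‖
    (fun f => by
      refine (ContinuousMap.norm_le _ (by positivity)).2 fun p => ?_
      refine (norm_inner_le_norm _ _).trans (mul_le_mul_of_nonneg_left ?_ (norm_nonneg v))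
      rw [ContinuousLinearMap.norm_map_of_mem_unitary (π p.2).2]
      exact f.norm_coe_le_norm p.1)

theorem coordMap_apply (π : Ω →ₜ* UN N) (v : CN N) (f : C(K, CN N)) (p : K × Ω) :
    coordMap K π v f p = inner ℂ v ((π p.2 : CN N →L[ℂ] CN N) (f p.1)) := rfl

/-- The function `x ↦ (F i (x, 1))ᵢ`, which recovers `f` from its coordinates `⟪e i, π(ω) f(x)⟫`. -/
def assemble (F : Fin N → C(K × Ω, ℂ)) : C(K, CN N) :=
  ⟨fun x => WithLp.toLp 2 fun i => F i (x, 1), by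
    refine (PiLp.continuous_toLp 2 _).comp (continuous_pi fun i => ?_)
    exact (F i).continuous.comp (Continuous.prodMk_left 1)⟩

theorem norm_sub_assemble_le (π : Ω →ₜ* UN N) (F : Fin N → C(K × Ω, ℂ)) (f : C(K, CN N)) {ε : ℝ}
    (hε : 0 ≤ ε)
    (h : ∀ i, ‖coordMap K π (EuclideanSpace.single i 1) f - F i‖ ≤ ε) :
    ‖f - assemble F‖ ≤ N * ε := by
  refine (ContinuousMap.norm_le _ (by positivity)).2 fun x => ?_
  have h1 : ∀ i, ‖(f x - assemble F x) i‖ ≤ ε := fun i => by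
    have h2 := ((coordMap K π (EuclideanSpace.single i 1) f - F i).norm_coe_le_norm (x, 1)).trans
      (h i)
    rw [ContinuousMap.sub_apply, coordMap_apply, map_one] at h2
    simpa [EuclideanSpace.inner_single_left, assemble] using h2
  have h3 : ‖f x - assemble F x‖ ≤ ∑ i, ‖(f x - assemble F x) i‖ := by
    have h4 := (EuclideanSpace.basisFun (Fin N) ℂ).sum_repr (f x - assemble F x)
    conv_lhs => rw [← h4]
    refine (norm_sum_le _ _).trans (Finset.sum_le_sum fun i _ => ?_)
    rw [norm_smul, (EuclideanSpace.basisFun (Fin N) ℂ).orthonormal.1 i, mul_one]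
    rfl
  calc ‖f x - assemble F x‖ ≤ ∑ i, ‖(f x - assemble F x) i‖ := h3
    _ ≤ ∑ _i : Fin N, ε := Finset.sum_le_sum fun i _ => h1 i
    _ = N * ε := by simp

variable [IsTopologicalGroup Ω]

theorem skewKoopman_apply (γ : ContinuousCocycle G K Ω) (g : G) (F : C(K × Ω, ℂ)) (p : K × Ω) :
    skewKoopman γ g F p = F (g • p.1, p.2 * γ.toFun g p.1) := rfl

theorem norm_skewKoopman_le (γ : ContinuousCocycle G K Ω) (g : G) (F : C(K × Ω, ℂ)) :
    ‖skewKoopman γ g F‖ ≤ ‖F‖ :=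
  (ContinuousMap.norm_le _ (norm_nonneg F)).2 fun p => F.norm_coe_le_norm (skewMap γ g p)

theorem skewKoopman_mul (γ : ContinuousCocycle G K Ω) (g h : G) (F : C(K × Ω, ℂ)) :
    skewKoopman γ (g * h) F = skewKoopman γ h (skewKoopman γ g F) := by
  ext p
  simp [skewKoopman_apply, γ.map_mul, mul_smul, mul_assoc]

theorem continuous_skewKoopman (γ : ContinuousCocycle G K Ω) (F : C(K × Ω, ℂ)) :
    Continuous fun g => skewKoopman γ g F := by
  refine continuous_of_continuous_uncurry (F.continuous.comp ?_)
  have h1 : Continuous fun p : G × K × Ω => p.1 • p.2.1 :=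
    continuous_fst.smul (continuous_fst.comp continuous_snd)
  have h2 : Continuous fun p : G × K × Ω => γ.toFun p.1 p.2.1 :=
    γ.continuous_toFun.comp (continuous_fst.prodMk (continuous_fst.comp continuous_snd))
  exact h1.prodMk ((continuous_snd.comp continuous_snd).mul h2)

/-- The coordinate maps intertwine the operators `π(γ(g, ·)) S_g` with the skew product Koopman
operators. -/
theorem skewKoopman_coordMap (γ : ContinuousCocycle G K Ω) (π : Ω →ₜ* UN N) (v : CN N) (g : G)
    (f : C(K, CN N)) :
    skewKoopman γ g (coordMap K π v f) = coordMap K π v (koopmanC (γ.map π) g f) := by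
  ext p
  have h : π (p.2 * γ.toFun g p.1) = π p.2 * π (γ.toFun g p.1) := π.map_mul' _ _
  rw [skewKoopman_apply, coordMap_apply, h]
  rfl

/-- Convex combinations of the skew product Koopman operators act on all coordinate functions of `π`
through one and the same convex combination of the operators `π(γ(g, ·)) S_g`. -/
theorem exists_intertwining_of_mem_convexHull (γ : ContinuousCocycle G K Ω) (π : Ω →ₜ* UN N)
    {B : C(K × Ω, ℂ) →L[ℂ] C(K × Ω, ℂ)} (hB : B ∈ convexHull ℝ (range (skewKoopman γ))) :
    ∃ A ∈ convexHull ℝ (range (koopmanC (γ.map π))),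
      ∀ v f, B (coordMap K π v f) = coordMap K π v (A f) := by
  let S : Set (C(K × Ω, ℂ) →L[ℂ] C(K × Ω, ℂ)) := {B | ∃ A ∈ convexHull ℝ
    (range (koopmanC (γ.map π))), ∀ v f, B (coordMap K π v f) = coordMap K π v (A f)}
  suffices convexHull ℝ (range (skewKoopman γ)) ⊆ S from this hB
  refine convexHull_min ?_ ?_
  · rintro _ ⟨g, rfl⟩
    exact ⟨_, subset_convexHull ℝ _ ⟨g, rfl⟩, fun v f => skewKoopman_coordMap γ π v g f⟩
  · rintro B₁ ⟨A₁, hA₁, h₁⟩ B₂ ⟨A₂, hA₂, h₂⟩ a b ha hb hab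
    refine ⟨a • A₁ + b • A₂, convex_convexHull ℝ _ hA₁ hA₂ ha hb hab, fun v f => ?_⟩
    have e1 : (a • B₁ + b • B₂) (coordMap K π v f) =
      a • B₁ (coordMap K π v f) + b • B₂ (coordMap K π v f) := rfl
    have e2 : (a • A₁ + b • A₂) f = (a : ℂ) • A₁ f + (b : ℂ) • A₂ f := rfl
    rw [e1, e2, h₁, h₂, map_add, map_smul, map_smul]
    rfl

/-- If the skew product Koopman semigroup is mean ergodic, then closed convex hulls of orbits in
`C(K, ℂ^N)` contain fixed functions, assembled from the projections of their coordinates. -/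
theorem exists_fixed_of_isMeanErgodic (γ : ContinuousCocycle G K Ω) (π : Ω →ₜ* UN N)
    (hT : IsMeanErgodic (skewKoopman γ)) (f : C(K, CN N)) :
    ∃ f₀ ∈ fixedSpace (koopmanC (γ.map π)),
      f₀ ∈ closure (convexHull ℝ (range fun g => koopmanC (γ.map π) g f)) := by
  obtain ⟨P, hP, hPQ⟩ := hT
  let e : Fin N → CN N := fun i => EuclideanSpace.single i 1
  let f₀ : C(K, CN N) := assemble fun i => P (coordMap K π (e i) f)
  have happrox : ∀ ε > 0, ∃ A ∈ convexHull ℝ (range (koopmanC (γ.map π))),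
      (∀ i, ‖coordMap K π (e i) (A f) - P (coordMap K π (e i) f)‖ ≤ ε) := by
    intro ε hε
    obtain ⟨B, hB, hBP⟩ := mem_sotClosure_iff.1 hP (range fun i => coordMap K π (e i) f)
      (finite_range _) ε hε
    obtain ⟨A, hA, hAB⟩ := exists_intertwining_of_mem_convexHull γ π hB
    exact ⟨A, hA, fun i => by rw [← hAB]; exact (hBP _ ⟨i, rfl⟩).le⟩
  have hN : ∀ ε > 0, 0 < ε / (N + 1 : ℝ) := fun ε hε => by positivity
  have hNle : ∀ ε > 0, N * (ε / (N + 1 : ℝ)) < ε := fun ε hε => by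
    rw [mul_div_assoc', div_lt_iff₀ (by positivity)]
    nlinarith
  refine ⟨f₀, fun g => ?_, ?_⟩
  · refine eq_of_forall_dist_le fun ε hε => ?_
    obtain ⟨A, hA, h⟩ := happrox _ (hN _ (half_pos hε))
    have h1 := (norm_sub_assemble_le π _ _ (hN _ (half_pos hε)).le h).trans
      (hNle _ (half_pos hε)).le
    have h2 : ∀ i, ‖coordMap K π (e i) (koopmanC (γ.map π) g (A f)) -
        P (coordMap K π (e i) f)‖ ≤ ε / 2 / (N + 1 : ℝ) := fun i => by
      have h3 : P (coordMap K π (e i) f) = skewKoopman γ g (P (coordMap K π (e i) f)) :=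
        (DFunLike.congr_fun (hPQ _ (subset_sotClosure (subset_convexHull ℝ _ ⟨g, rfl⟩))).2 _).symm
      rw [h3, ← skewKoopman_coordMap, ← map_sub]
      exact (norm_skewKoopman_le γ g _).trans (h i)
    have h4 := (norm_sub_assemble_le π _ _ (hN _ (half_pos hε)).le h2).trans
      (hNle _ (half_pos hε)).le
    have h5 : ‖koopmanC (γ.map π) g (f₀ - A f)‖ ≤ ε / 2 := by
      rw [norm_sub_rev] at h1
      refine (ContinuousMap.norm_le _ (half_pos hε).le).2 fun x => ?_
      rw [norm_koopmanC_apply]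
      exact ((f₀ - A f).norm_coe_le_norm _).trans h1
    have h6 : koopmanC (γ.map π) g f₀ - f₀ =
        koopmanC (γ.map π) g (f₀ - A f) + (koopmanC (γ.map π) g (A f) - f₀) := by
      rw [map_sub]
      abel
    rw [dist_eq_norm, h6]
    exact (norm_add_le _ _).trans ((add_le_add h5 h4).trans_eq (add_halves ε))
  · rw [← image_eval_convexHull, Metric.mem_closure_iff]
    intro ε hε
    obtain ⟨A, hA, h⟩ := happrox _ (hN ε hε)
    refine ⟨A f, ⟨A, hA, rfl⟩, ?_⟩
    rw [dist_comm, dist_eq_norm]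
    exact (norm_sub_assemble_le π _ _ (hN ε hε).le h).trans_lt (hNle ε hε)

theorem exists_fixed_mem_closure_coordMap (γ : ContinuousCocycle G K Ω) (π : Ω →ₜ* UN N)
    (v : CN N) {f f₀ : C(K, CN N)} (hf₀ : f₀ ∈ fixedSpace (koopmanC (γ.map π)))
    (h : f₀ ∈ closure (convexHull ℝ (range fun g => koopmanC (γ.map π) g f))) :
    ∃ F₀ ∈ fixedSpace (skewKoopman γ),
      F₀ ∈ closure (convexHull ℝ (range fun g => skewKoopman γ g (coordMap K π v f))) := by
  refine ⟨coordMap K π v f₀, fun g => by rw [skewKoopman_coordMap, hf₀ g], ?_⟩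
  simp_rw [skewKoopman_coordMap]
  exact map_mem_closure_convexHull (coordMap K π v) h

end Skew

/-! ### Density of elementary tensors -/

section Tensor

variable {X Y : Type*} [TopologicalSpace X] [CompactSpace X] [T2Space X]
  [TopologicalSpace Y] [CompactSpace Y] [T2Space Y]

variable (X Y) in
/-- The linear combinations of functions `(x, y) ↦ u x * w y`, as a star subalgebra. -/
def tensorStarSubalgebra : StarSubalgebra ℂ C(X × Y, ℂ) :=
  let S : Set C(X × Y, ℂ) := range fun p : C(X, ℂ) × C(Y, ℂ) => ContinuousMap.prodMul p.1 p.2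
  { (Submodule.span ℂ S).toSubalgebra
      (Submodule.subset_span ⟨(1, 1), by ext; simp⟩)
      (fun a b ha hb => by
        refine Submodule.span_mono ?_ (Submodule.span_mul_span ℂ S S ▸ Submodule.mul_mem_mul ha hb)
        rintro _ ⟨_, ⟨p, rfl⟩, _, ⟨q, rfl⟩, rfl⟩
        exact ⟨(p.1 * q.1, p.2 * q.2), by ext; simp; ring⟩) with
    star_mem' := fun {a} ha => by
      change star a ∈ Submodule.span ℂ S
      have ha' : a ∈ Submodule.span ℂ S := ha
      clear ha
      induction ha' using Submodule.span_induction with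
      | mem a h =>
        obtain ⟨p, rfl⟩ := h
        exact Submodule.subset_span ⟨(star p.1, star p.2), by ext; simp⟩
      | zero => rw [star_zero]; exact zero_mem _
      | add a b ha hb iha ihb => rw [star_add]; exact add_mem iha ihb
      | smul c a ha iha => rw [star_smul]; exact Submodule.smul_mem _ _ iha }

theorem exists_continuousMap_complex_ne {a b : X} (hab : a ≠ b) : ∃ u : C(X, ℂ), u a ≠ u b := by
  obtain ⟨u, hu⟩ := exists_continuous_zero_one_of_isClosed (isClosed_singleton (x := a))
    (isClosed_singleton (x := b)) (disjoint_singleton.2 hab)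
  refine ⟨⟨fun z => (u z : ℂ), Complex.continuous_ofReal.comp u.continuous⟩, ?_⟩
  have h0 : u a = 0 := hu.1 rfl
  have h1 : u b = 1 := hu.2.1 rfl
  simp [h0, h1]

theorem dense_span_prodMul : Dense (Submodule.span ℂ
    (range fun p : C(X, ℂ) × C(Y, ℂ) => ContinuousMap.prodMul p.1 p.2) : Set C(X × Y, ℂ)) := by
  have h := ContinuousMap.starSubalgebra_topologicalClosure_eq_top_of_separatesPoints
    (tensorStarSubalgebra X Y) (fun p q hpq => by
      by_cases h1 : p.1 = q.1
      · obtain ⟨w, hw⟩ := exists_continuousMap_complex_ne (fun h2 => hpq (Prod.ext h1 h2))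
        exact ⟨_, ⟨_, Submodule.subset_span ⟨(1, w), rfl⟩, rfl⟩, by simpa using hw⟩
      · obtain ⟨u, hu⟩ := exists_continuousMap_complex_ne h1
        exact ⟨_, ⟨_, Submodule.subset_span ⟨(u, 1), rfl⟩, rfl⟩, by simpa using hu⟩)
  have h2 : closure (tensorStarSubalgebra X Y : Set C(X × Y, ℂ)) = univ := by
    rw [← StarSubalgebra.topologicalClosure_coe, h]
    rfl
  exact dense_iff_closure_eq.2 h2

end Tensor

/-! ### Integral operators with continuous kernel -/

section Kernel

variable {X : Type*} [TopologicalSpace X] [CompactSpace X] [MeasurableSpace X]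
  [BorelSpace X] {ν : Measure X} [IsProbabilityMeasure ν]

theorem norm_toLp_le_norm (u : C(X, ℂ)) : ‖ContinuousMap.toLp 2 ν ℂ u‖ ≤ ‖u‖ := by
  refine (Lp.norm_le_of_ae_bound (norm_nonneg u) (C := ‖u‖) ?_).trans ?_
  · filter_upwards [ContinuousMap.coeFn_toLp (p := 2) (𝕜 := ℂ) ν u] with x hx
    rw [hx]
    exact u.norm_coe_le_norm x
  · simp [measureUnivNNReal]

/-- The operator `L² → C(X)` with continuous kernel `κ`, `f ↦ (x ↦ ∫ κ(x, y) f(y) dν(y))`, the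
integral being written as an inner product. -/
def kernelOp (ν : Measure X) [IsProbabilityMeasure ν] :
    C(X × X, ℂ) →L[ℂ] Lp ℂ 2 ν →L[ℂ] C(X, ℂ) :=
  LinearMap.mkContinuous₂
    (LinearMap.mk₂ ℂ (fun (κ : C(X × X, ℂ)) (f : Lp ℂ 2 ν) =>
        (⟨fun x => inner ℂ (ContinuousMap.toLp 2 ν ℂ (star (κ.curry x))) f,
          ((ContinuousMap.toLp 2 ν ℂ).continuous.comp
            (continuous_star.comp κ.curry.continuous)).inner continuous_const⟩ : C(X, ℂ)))
      (fun κ κ' f => by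
        ext x
        simp [inner_add_left])
      (fun c κ f => by
        ext x
        simp [inner_smul_left])
      (fun κ f f' => by ext x; simp [inner_add_right])
      (fun c κ f => by ext x; simp [inner_smul_right])) 1
    (fun κ f => by
      rw [one_mul]
      refine (ContinuousMap.norm_le _ (by positivity)).2 fun x => ?_
      refine (norm_inner_le_norm _ _).trans (mul_le_mul_of_nonneg_right ?_ (norm_nonneg f))
      refine (norm_toLp_le_norm _).trans ?_
      rw [norm_star]
      exact (ContinuousMap.norm_le _ (norm_nonneg κ)).2 fun y => κ.norm_coe_le_norm (x, y))

theorem kernelOp_apply (κ : C(X × X, ℂ)) (f : Lp ℂ 2 ν) (x : X) :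
    kernelOp ν κ f x = inner ℂ (ContinuousMap.toLp 2 ν ℂ (star (κ.curry x))) f := rfl

theorem kernelOp_toLp (κ : C(X × X, ℂ)) (f : C(X, ℂ)) (x : X) :
    kernelOp ν κ (ContinuousMap.toLp 2 ν ℂ f) x = ∫ y, κ (x, y) * f y ∂ν := by
  rw [kernelOp_apply, ContinuousMap.inner_toLp]
  refine integral_congr_ae (.of_forall fun y => ?_)
  simp [mul_comm]

theorem kernelOp_prodMul (a b : C(X, ℂ)) (f : Lp ℂ 2 ν) :
    kernelOp ν (ContinuousMap.prodMul a b) f =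
      (inner ℂ (ContinuousMap.toLp 2 ν ℂ (star b)) f : ℂ) • a := by
  ext x
  have : (ContinuousMap.prodMul a b).curry x = a x • b := by ext y; simp
  rw [kernelOp_apply, this, star_smul, map_smul, inner_smul_left]
  simp [mul_comm]

variable [T2Space X]

theorem isCompactOperator_kernelOp (κ : C(X × X, ℂ)) : IsCompactOperator (kernelOp ν κ) := by
  let S : Submodule ℂ C(X × X, ℂ) :=
    (compactOperator (RingHom.id ℂ) (Lp ℂ 2 ν) C(X, ℂ)).comap (kernelOp ν).toLinearMap
  have hS : IsClosed (S : Set C(X × X, ℂ)) :=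
    isClosed_setOfPred_isCompactOperator.preimage (kernelOp ν).continuous
  have hspan : Submodule.span ℂ
      (range fun p : C(X, ℂ) × C(X, ℂ) => ContinuousMap.prodMul p.1 p.2) ≤ S := by
    refine Submodule.span_le.2 ?_
    rintro _ ⟨⟨a, b⟩, rfl⟩
    -- an elementary tensor yields an operator of rank at most one
    have h : kernelOp ν (ContinuousMap.prodMul a b) =
        (ContinuousLinearMap.toSpanSingleton ℂ a).comp
          (innerSL ℂ (ContinuousMap.toLp 2 ν ℂ (star b))) := by
      ext1 f
      rw [kernelOp_prodMul]
      rfl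
    change IsCompactOperator (kernelOp ν (ContinuousMap.prodMul a b))
    rw [h]
    exact (isCompactOperator_of_locallyCompactSpace_rng
      (ContinuousLinearMap.toSpanSingleton ℂ a)).comp_clm _
  exact closure_minimal hspan hS (dense_span_prodMul κ)

/-- The operator with kernel `κ(x, y)` is adjoint to the operator with kernel `conj κ(y, x)`. -/
theorem inner_kernelOp (κ : C(X × X, ℂ)) (f g : Lp ℂ 2 ν) :
    inner ℂ (ContinuousMap.toLp 2 ν ℂ (kernelOp ν κ f)) g =
      inner ℂ f (ContinuousMap.toLp 2 ν ℂ
        (kernelOp ν (star (κ.comp ContinuousMap.prodSwap)) g)) := by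
  let S : Set C(X × X, ℂ) := {κ | inner ℂ (ContinuousMap.toLp 2 ν ℂ (kernelOp ν κ f)) g =
      inner ℂ f (ContinuousMap.toLp 2 ν ℂ
        (kernelOp ν (star (κ.comp ContinuousMap.prodSwap)) g))}
  have hS : IsClosed S := by
    refine isClosed_eq ?_ ?_
    · exact ((ContinuousMap.toLp 2 ν ℂ).continuous.comp
        ((kernelOp ν).continuous.clm_apply continuous_const)).inner continuous_const
    · exact continuous_const.inner ((ContinuousMap.toLp 2 ν ℂ).continuous.comp
        (((kernelOp ν).continuous.comp (continuous_star.comp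
          (ContinuousMap.continuous_precomp _))).clm_apply continuous_const))
  refine closure_minimal (fun κ hκ => ?_) hS (dense_span_prodMul κ)
  induction hκ using Submodule.span_induction with
  | mem κ h =>
    obtain ⟨⟨a, b⟩, rfl⟩ := h
    have h1 : star ((ContinuousMap.prodMul a b).comp ContinuousMap.prodSwap) =
        ContinuousMap.prodMul (star b) (star a) := by
      ext p
      simp [mul_comm]
    change inner ℂ (ContinuousMap.toLp 2 ν ℂ (kernelOp ν (ContinuousMap.prodMul a b) f)) g = _
    rw [h1, kernelOp_prodMul, kernelOp_prodMul, map_smul, map_smul, inner_smul_left,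
      inner_smul_right, star_star, inner_conj_symm, mul_comm]
  | zero => simp [S]
  | add κ κ' _ _ h h' =>
    have h1 : star ((κ + κ').comp ContinuousMap.prodSwap) =
      star (κ.comp ContinuousMap.prodSwap) + star (κ'.comp ContinuousMap.prodSwap) := by
      ext p
      simp
    change inner ℂ (ContinuousMap.toLp 2 ν ℂ (kernelOp ν (κ + κ') f)) g = _
    rw [h1, map_add, map_add, _root_.add_apply, _root_.add_apply, map_add,
      map_add, inner_add_left, inner_add_right, h, h']
  | smul c κ _ h =>
    have h1 : star ((c • κ).comp ContinuousMap.prodSwap) =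
      star c • star (κ.comp ContinuousMap.prodSwap) := by
      ext p
      simp
    change inner ℂ (ContinuousMap.toLp 2 ν ℂ (kernelOp ν (c • κ) f)) g = _
    rw [h1, map_smul, map_smul, _root_.smul_apply, _root_.smul_apply,
      map_smul, map_smul, inner_smul_left, inner_smul_right, h]
    rfl

end Kernel

/-! ### The right regular representation and the Peter–Weyl theorem -/

section PeterWeyl

variable {Ω : Type*} [Group Ω] [TopologicalSpace Ω]

variable (Ω) in
/-- The linear span, in `C(Ω)`, of the matrix coefficients `ω ↦ ⟪v, π(ω) w⟫` of the irreducible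
unitary representations of `Ω`. -/
def matrixCoeffSpan : Submodule ℂ C(Ω, ℂ) :=
  Submodule.span ℂ {c | ∃ (N : ℕ) (π : Ω →ₜ* UN N) (_ : π ∈ irreps Ω N) (v w : CN N),
    ∀ ω, c ω = inner ℂ v ((π ω : CN N →L[ℂ] CN N) w)}

variable [IsTopologicalGroup Ω]

/-- The right translate `y ↦ u (y ω)`. -/
def rightTranslate (ω : Ω) (u : C(Ω, ℂ)) : C(Ω, ℂ) :=
  u.comp ⟨fun y => y * ω, continuous_mul_const ω⟩

theorem continuous_rightTranslate (u : C(Ω, ℂ)) : Continuous fun ω : Ω => rightTranslate ω u :=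
  continuous_of_continuous_uncurry
    (u.continuous.comp (continuous_snd.mul continuous_fst))

variable [MeasurableSpace Ω] [BorelSpace Ω]

/-- Compact groups are unimodular. -/
theorem isMulRightInvariant_of_compactSpace [CompactSpace Ω] (ν : Measure Ω)
    [IsProbabilityMeasure ν] [ν.IsHaarMeasure] : ν.IsMulRightInvariant := by
  refine ⟨fun ω => ?_⟩
  have hc : Continuous fun y : Ω => y * ω := continuous_mul_const ω
  have : IsProbabilityMeasure (ν.map fun y => y * ω) :=
    Measure.isProbabilityMeasure_map hc.aemeasurable
  have : (ν.map fun y => y * ω).IsHaarMeasure :=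
    Measure.isHaarMeasure_map_mul_right ν ω
  exact Measure.isHaarMeasure_eq_of_isProbabilityMeasure _ _

variable {ν : Measure Ω} [ν.IsMulRightInvariant]

variable (ν) in
/-- The right regular representation of `Ω` on `L²`. -/
def rightRegular (ω : Ω) : Lp ℂ 2 ν →ₗᵢ[ℂ] Lp ℂ 2 ν :=
  Lp.compMeasurePreservingₗᵢ ℂ (fun y => y * ω) (measurePreserving_mul_right ν ω)

theorem rightRegular_mul (ω ω' : Ω) (f : Lp ℂ 2 ν) :
    rightRegular ν (ω * ω') f = rightRegular ν ω (rightRegular ν ω' f) := by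
  have h := Lp.compMeasurePreserving_comp_apply f (measurePreserving_mul_right ν ω')
    (measurePreserving_mul_right ν ω)
  refine Eq.trans ?_ h
  have h2 : ((fun y => y * ω') ∘ fun y => y * ω) = fun y => y * (ω * ω') := by
    ext y
    simp [mul_assoc]
  change Lp.compMeasurePreserving _ _ f = _
  congr 1
  simp only [h2]

theorem rightRegular_one (f : Lp ℂ 2 ν) : rightRegular ν 1 f = f := by
  have h := Lp.compMeasurePreserving_id_apply f
  refine Eq.trans ?_ h
  have h2 : (fun y : Ω => y * 1) = id := by
    ext y
    simp
  change Lp.compMeasurePreserving _ _ f = _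
  congr 1
  simp only [h2]

/-! A right-invariant subspace `V` of dimension `N` carries, in orthonormal coordinates, a unitary
representation on `ℂ^N`. -/

section Coordinates

/-- The right regular representation on an invariant subspace `V`, in coordinates. -/
def coordRep {N : ℕ} (V : Submodule ℂ (Lp ℂ 2 ν)) (hinv : ∀ ω, ∀ v ∈ V, rightRegular ν ω v ∈ V)
    (e : V ≃ₗᵢ[ℂ] CN N) (ω : Ω) : CN N →L[ℂ] CN N :=
  e.toLinearIsometry.toContinuousLinearMap ∘L
    (((rightRegular ν ω).toContinuousLinearMap ∘L V.subtypeL).codRestrict V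
      fun v => hinv ω v v.2) ∘L e.symm.toLinearIsometry.toContinuousLinearMap

variable {N : ℕ} {V : Submodule ℂ (Lp ℂ 2 ν)} (hinv : ∀ ω, ∀ v ∈ V, rightRegular ν ω v ∈ V)
  (e : V ≃ₗᵢ[ℂ] CN N)

/-- `coordRep` is the right regular representation transported along `e`. -/
theorem coe_symm_coordRep (ω : Ω) (z : CN N) :
    ((e.symm (coordRep V hinv e ω z) : V) : Lp ℂ 2 ν) = rightRegular ν ω (e.symm z : V) := by
  simp [coordRep]
  rfl

theorem coordRep_mul (ω ω' : Ω) (z : CN N) :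
    coordRep V hinv e (ω * ω') z = coordRep V hinv e ω (coordRep V hinv e ω' z) := by
  apply e.symm.injective
  apply Subtype.ext
  rw [coe_symm_coordRep, coe_symm_coordRep, coe_symm_coordRep, rightRegular_mul]

theorem coordRep_one (z : CN N) : coordRep V hinv e 1 z = z := by
  apply e.symm.injective
  apply Subtype.ext
  rw [coe_symm_coordRep, rightRegular_one]

theorem norm_coordRep (ω : Ω) (z : CN N) : ‖coordRep V hinv e ω z‖ = ‖z‖ := by
  rw [← e.symm.norm_map, Submodule.coe_norm, coe_symm_coordRep, LinearIsometry.norm_map,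
    ← Submodule.coe_norm, e.symm.norm_map]

theorem coordRep_mem_unitary (ω : Ω) : coordRep V hinv e ω ∈ unitary (CN N →L[ℂ] CN N) := by
  have hmul : ∀ ω ω', coordRep V hinv e ω * coordRep V hinv e ω' = coordRep V hinv e (ω * ω') :=
    fun ω ω' => ContinuousLinearMap.ext fun z => (coordRep_mul hinv e ω ω' z).symm
  have hone : coordRep V hinv e 1 = 1 := ContinuousLinearMap.ext fun z => coordRep_one hinv e z
  have hstar : star (coordRep V hinv e ω) = coordRep V hinv e ω⁻¹ := by
    refine ((ContinuousLinearMap.eq_adjoint_iff _ _).2 fun x y => ?_).symm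
    have h : ∀ a b, inner ℂ (coordRep V hinv e ω a) (coordRep V hinv e ω b) = inner ℂ a b :=
      (LinearIsometry.mk (coordRep V hinv e ω).toLinearMap (norm_coordRep hinv e ω)).inner_map_map
    rw [← h, ← coordRep_mul, mul_inv_cancel, coordRep_one]
  rw [Unitary.mem_iff, hstar, hmul, hmul, inv_mul_cancel, mul_inv_cancel, hone]
  exact ⟨rfl, rfl⟩

/-- The representation `coordRep` as a continuous homomorphism to the unitary group. -/
def unitaryRep (hcont : ∀ v ∈ V, Continuous fun ω => rightRegular ν ω v) : Ω →ₜ* UN N where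
  toFun ω := ⟨coordRep V hinv e ω, coordRep_mem_unitary hinv e ω⟩
  map_one' := Subtype.ext (ContinuousLinearMap.ext fun z => coordRep_one hinv e z)
  map_mul' ω ω' := Subtype.ext (ContinuousLinearMap.ext fun z => coordRep_mul hinv e ω ω' z)
  continuous_toFun := by
    refine Continuous.subtype_mk (continuous_clm_apply.2 fun z => ?_) _
    exact e.continuous.comp (Continuous.subtype_mk (hcont _ (e.symm z).2) _)

/-- If `V` has no proper invariant subspaces, then `unitaryRep` is irreducible. -/
theorem unitaryRep_mem_irreps (hcont : ∀ v ∈ V, Continuous fun ω => rightRegular ν ω v)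
    (hV : V ≠ ⊥)
    (hirr : ∀ W ≤ V, (∀ ω, ∀ v ∈ W, rightRegular ν ω v ∈ W) → W = ⊥ ∨ W = V) :
    unitaryRep hinv e hcont ∈ irreps Ω N := by
  let j : CN N →ₗ[ℂ] Lp ℂ 2 ν := V.subtype ∘ₗ e.symm.toLinearEquiv.toLinearMap
  have hj : Function.Injective j := V.injective_subtype.comp e.symm.injective
  have hjrange : LinearMap.range j = V := by
    rw [LinearMap.range_comp, LinearEquiv.range, Submodule.map_top, Submodule.range_subtype]
  unfold irreps
  rw [mem_ofPred_eq]
  refine { exists_pair_ne := ⟨⊥, ⊤, fun h => hV ?_⟩, eq_bot_or_eq_top := fun W => ?_ }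
  · have h1 : (⊥ : Submodule ℂ (CN N)) = ⊤ := congrArg Subrepresentation.toSubmodule h
    rw [← hjrange, ← Submodule.map_top, ← h1, Submodule.map_bot]
  · have h := hirr (W.toSubmodule.map j)
      (LinearMap.map_le_range.trans hjrange.le) (fun ω v hv => by
        obtain ⟨z, hz, rfl⟩ := hv
        exact ⟨coordRep V hinv e ω z, W.apply_mem_toSubmodule ω hz, coe_symm_coordRep hinv e ω z⟩)
    rcases h with h | h
    · left
      apply Subrepresentation.toSubmodule_injective
      exact Submodule.map_injective_of_injective hj (h.trans (Submodule.map_bot j).symm)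
    · right
      apply Subrepresentation.toSubmodule_injective
      refine Submodule.map_injective_of_injective hj ?_
      rw [h]
      exact (hjrange.symm.trans (Submodule.map_top j).symm)

end Coordinates

variable [CompactSpace Ω] [IsProbabilityMeasure ν]

theorem rightRegular_toLp (ω : Ω) (u : C(Ω, ℂ)) :
    rightRegular ν ω (ContinuousMap.toLp 2 ν ℂ u) = ContinuousMap.toLp 2 ν ℂ (rightTranslate ω u) :=
  rfl

/-- The kernel `(x, y) ↦ k (x y⁻¹)` of convolution by `k`. -/
def convKernel (k : C(Ω, ℂ)) : C(Ω × Ω, ℂ) :=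
  k.comp ⟨fun p => p.1 * p.2⁻¹, continuous_fst.mul continuous_snd.inv⟩

/-- Convolution operators commute with right translations. -/
theorem kernelOp_rightRegular (k : C(Ω, ℂ)) (ω : Ω) (f : Lp ℂ 2 ν) :
    kernelOp ν (convKernel k) (rightRegular ν ω f) =
      rightTranslate ω (kernelOp ν (convKernel k) f) := by
  ext x
  change kernelOp ν (convKernel k) (rightRegular ν ω f) x = kernelOp ν (convKernel k) f (x * ω)
  refine Eq.trans ?_ ((rightRegular ν ω).inner_map_map _ f)
  rw [kernelOp_apply, rightRegular_toLp]
  congr 2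
  ext y
  simp [convKernel, rightTranslate, mul_assoc]

/-- Eigenvectors of a convolution operator are continuous functions, so their right translates depend
continuously on the group element. -/
theorem continuous_rightRegular_of_eigen {k : C(Ω, ℂ)} {lam : ℂ} (hlam : lam ≠ 0) {v : Lp ℂ 2 ν}
    (hv : ContinuousMap.toLp 2 ν ℂ (kernelOp ν (convKernel k) v) = lam • v) :
    Continuous fun ω => rightRegular ν ω v := by
  have h : v = ContinuousMap.toLp 2 ν ℂ (lam⁻¹ • kernelOp ν (convKernel k) v) := by
    rw [map_smul, hv, smul_smul, inv_mul_cancel₀ hlam, one_smul]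
  rw [h]
  simp_rw [rightRegular_toLp]
  exact (ContinuousMap.toLp 2 ν ℂ).continuous.comp (continuous_rightTranslate _)

/-- Evaluating at `1` turns the elements of `V`, smoothed by the convolution operator, into matrix
coefficients. -/
theorem exists_kernelOp_eq_inner (k : C(Ω, ℂ)) {N : ℕ} {V : Submodule ℂ (Lp ℂ 2 ν)}
    (hinv : ∀ ω, ∀ v ∈ V, rightRegular ν ω v ∈ V) (e : V ≃ₗᵢ[ℂ] CN N) (v : V)
    (hcont : ∀ v ∈ V, Continuous fun ω => rightRegular ν ω v) :
    ∃ a b : CN N, ∀ ω, kernelOp ν (convKernel k) (v : Lp ℂ 2 ν) ω =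
      inner ℂ a ((unitaryRep hinv e hcont ω : CN N →L[ℂ] CN N) b) := by
  let ℓ : StrongDual ℂ (CN N) :=
    (ContinuousMap.evalCLM ℂ (1 : Ω)) ∘L kernelOp ν (convKernel k) ∘L V.subtypeL ∘L
      e.symm.toLinearIsometry.toContinuousLinearMap
  refine ⟨(InnerProductSpace.toDual ℂ (CN N)).symm ℓ, e v, fun ω => ?_⟩
  rw [InnerProductSpace.toDual_symm_apply]
  change _ = kernelOp ν (convKernel k) ((e.symm (coordRep V hinv e ω (e v)) : V) : Lp ℂ 2 ν) 1
  rw [coe_symm_coordRep, kernelOp_rightRegular, e.symm_apply_apply]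
  simp [rightTranslate]

/-- The convolution operator maps finite-dimensional invariant subspaces of its eigenspaces into the
span of the matrix coefficients, by decomposition into irreducible subspaces. -/
theorem kernelOp_mem_matrixCoeffSpan {k : C(Ω, ℂ)} {lam : ℂ} (hlam : lam ≠ 0) (n : ℕ) :
    ∀ V : Submodule ℂ (Lp ℂ 2 ν), FiniteDimensional ℂ V → Module.finrank ℂ V = n →
      (∀ ω, ∀ v ∈ V, rightRegular ν ω v ∈ V) →
      (∀ v ∈ V, ContinuousMap.toLp 2 ν ℂ (kernelOp ν (convKernel k) v) = lam • v) →
      ∀ v ∈ V, kernelOp ν (convKernel k) v ∈ matrixCoeffSpan Ω := by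
  induction n using Nat.strong_induction_on with
  | _ n ih =>
    intro V hfd hn hinv heig v hv
    by_cases hV : V = ⊥
    · rw [hV, Submodule.mem_bot] at hv
      rw [hv, map_zero]
      exact zero_mem _
    by_cases hirr : ∀ W ≤ V, (∀ ω, ∀ v ∈ W, rightRegular ν ω v ∈ W) → W = ⊥ ∨ W = V
    · have hcont : ∀ v ∈ V, Continuous fun ω => rightRegular ν ω v := fun v hv =>
        continuous_rightRegular_of_eigen hlam (heig v hv)
      let e : V ≃ₗᵢ[ℂ] CN (Module.finrank ℂ V) := (stdOrthonormalBasis ℂ V).repr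
      obtain ⟨a, b, hab⟩ := exists_kernelOp_eq_inner k hinv e ⟨v, hv⟩ hcont
      exact Submodule.subset_span
        ⟨_, unitaryRep hinv e hcont, unitaryRep_mem_irreps hinv e hcont hV hirr, a, b, hab⟩
    · push Not at hirr
      obtain ⟨W, hWV, hWinv, hW0, hW1⟩ := hirr
      have hWfd : FiniteDimensional ℂ W := Submodule.finiteDimensional_of_le hWV
      have hdec := Submodule.sup_orthogonal_inf_of_hasOrthogonalProjection hWV
      have hW'fd : FiniteDimensional ℂ (Wᗮ ⊓ V : Submodule ℂ (Lp ℂ 2 ν)) :=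
        Submodule.finiteDimensional_of_le inf_le_right
      have hW'inv : ∀ ω, ∀ v ∈ Wᗮ ⊓ V, rightRegular ν ω v ∈ Wᗮ ⊓ V := by
        rintro ω v ⟨hv1, hv2⟩
        refine ⟨(Submodule.mem_orthogonal W _).2 fun w hw => ?_, hinv ω v hv2⟩
        have h1 : rightRegular ν ω (rightRegular ν ω⁻¹ w) = w := by
          rw [← rightRegular_mul, mul_inv_cancel, rightRegular_one]
        rw [← h1, LinearIsometry.inner_map_map]
        exact (Submodule.mem_orthogonal W v).1 hv1 _ (hWinv ω⁻¹ w hw)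
      have hWlt : W < V := lt_of_le_of_ne hWV hW1
      have hW'lt : Wᗮ ⊓ V < V := by
        refine lt_of_le_of_ne inf_le_right fun h => hW0 ?_
        have h1 : W ≤ Wᗮ := hWV.trans (inf_eq_right.1 h)
        rw [← le_bot_iff, ← W.inf_orthogonal_eq_bot]
        exact le_inf le_rfl h1
      rw [← hdec] at hv
      obtain ⟨w, hw, w', hw', rfl⟩ := Submodule.mem_sup.1 hv
      rw [map_add]
      refine add_mem ?_ ?_
      · exact ih _ (hn ▸ Submodule.finrank_lt_finrank_of_lt hWlt) W hWfd rfl hWinv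
          (fun v hv => heig v (hWV hv)) w hw
      · exact ih _ (hn ▸ Submodule.finrank_lt_finrank_of_lt hW'lt) _ hW'fd rfl hW'inv
          (fun v hv => heig v hv.2) w' hw'

variable [T2Space Ω]

/-- Convolution by a symmetric function takes values in the closed span of the matrix coefficients,
by the spectral theorem for compact self-adjoint operators. -/
theorem kernelOp_mem_closure_matrixCoeffSpan [ν.IsOpenPosMeasure] {k : C(Ω, ℂ)}
    (hk : ∀ z, star (k z⁻¹) = k z) (f : Lp ℂ 2 ν) :
    kernelOp ν (convKernel k) f ∈ (matrixCoeffSpan Ω).topologicalClosure := by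
  let A : Lp ℂ 2 ν →L[ℂ] C(Ω, ℂ) := kernelOp ν (convKernel k)
  let T : Lp ℂ 2 ν →L[ℂ] Lp ℂ 2 ν := ContinuousMap.toLp 2 ν ℂ ∘L A
  have hA : IsCompactOperator A := isCompactOperator_kernelOp (convKernel k)
  have hcomp : IsCompactOperator T := hA.clm_comp (ContinuousMap.toLp 2 ν ℂ)
  have hsymm : T.IsSymmetric := fun f g => by
    have h := inner_kernelOp (ν := ν) (convKernel k) f g
    have h2 : star ((convKernel k).comp ContinuousMap.prodSwap) = convKernel k := by
      ext p
      simp [convKernel, ← hk (p.1 * p.2⁻¹)]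
    rw [h2] at h
    exact h
  have hbot := ContinuousLinearMap.orthogonalComplement_iSup_eigenspaces_eq_bot hcomp hsymm
  rw [← Submodule.topologicalClosure_eq_top_iff] at hbot
  let S : Submodule ℂ (Lp ℂ 2 ν) := (matrixCoeffSpan Ω).topologicalClosure.comap A.toLinearMap
  have hS : IsClosed (S : Set (Lp ℂ 2 ν)) :=
    (Submodule.isClosed_topologicalClosure _).preimage A.continuous
  have hle : (⨆ lam, Module.End.eigenspace (T : Module.End ℂ (Lp ℂ 2 ν)) lam) ≤ S := by
    refine iSup_le fun lam v hv => ?_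
    by_cases hlam : lam = 0
    · rw [hlam, Module.End.mem_eigenspace_iff, zero_smul] at hv
      have h0 : A v = 0 := ContinuousMap.toLp_injective ν (hv.trans (map_zero _).symm)
      change A v ∈ (matrixCoeffSpan Ω).topologicalClosure
      rw [h0]
      exact zero_mem _
    · have hfd := ContinuousLinearMap.finite_dimensional_eigenspace hcomp lam hlam
      refine Submodule.le_topologicalClosure _
        (kernelOp_mem_matrixCoeffSpan hlam _ _ hfd rfl ?_ (fun v hv => ?_) v hv)
      · intro ω v hv
        rw [Module.End.mem_eigenspace_iff] at hv ⊢
        change ContinuousMap.toLp 2 ν ℂ (kernelOp ν (convKernel k) (rightRegular ν ω v)) = _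
        rw [kernelOp_rightRegular, ← rightRegular_toLp]
        exact (congrArg (rightRegular ν ω) hv).trans (map_smul _ _ _)
      · exact Module.End.mem_eigenspace_iff.1 hv
  have htop := Submodule.topologicalClosure_minimal _ hle hS
  rw [hbot] at htop
  exact htop (Submodule.mem_top : f ∈ ⊤)

/-- Approximate identities: every continuous function is uniformly close to its convolution by
a symmetric probability density concentrated near `1`. -/
theorem exists_norm_kernelOp_sub_lt [ν.IsOpenPosMeasure] (f : C(Ω, ℂ)) {ε : ℝ} (hε : 0 < ε) :
    ∃ k : C(Ω, ℂ), (∀ z, star (k z⁻¹) = k z) ∧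
      ‖kernelOp ν (convKernel k) (ContinuousMap.toLp 2 ν ℂ f) - f‖ ≤ ε := by
  -- a neighbourhood of `1` on which left translation moves `f` by less than `ε`
  have hcont : Continuous fun z : Ω => f.comp ⟨fun y => z * y, continuous_const_mul z⟩ :=
    continuous_of_continuous_uncurry (f.continuous.comp (continuous_fst.mul continuous_snd))
  let U : Set Ω := {z | dist (f.comp ⟨fun y => z * y, continuous_const_mul z⟩) f < ε}
  have hUo : IsOpen U := isOpen_lt (hcont.dist continuous_const) continuous_const
  have hU1 : (1 : Ω) ∈ U := by
    have : f.comp ⟨fun y => 1 * y, continuous_const_mul (1 : Ω)⟩ = f := by ext; simp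
    change dist _ _ < ε
    rw [this, dist_self]
    exact hε
  have hUf : ∀ x y, x * y⁻¹ ∈ U → ‖f y - f x‖ ≤ ε := fun x y h => by
    have h1 := (ContinuousMap.dist_lt_iff hε).1 h y
    simp only [ContinuousMap.comp_apply, ContinuousMap.coe_mk, inv_mul_cancel_right] at h1
    rw [← dist_eq_norm, dist_comm]
    exact h1.le
  obtain ⟨h, hh0, hh1, hh⟩ := exists_continuous_zero_one_of_isClosed
    (hUo.inter hUo.inv).isClosed_compl (isClosed_singleton (x := (1 : Ω)))
    (disjoint_singleton_right.2 (by simp [hU1]))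
  let k₀ : C(Ω, ℝ) := h + h.comp ⟨fun z => z⁻¹, continuous_inv⟩
  have hk₀ : ∀ z, k₀ z = h z + h z⁻¹ := fun z => rfl
  have hk₀nonneg : 0 ≤ k₀ := fun z => add_nonneg (hh z).1 (hh z⁻¹).1
  have hk₀U : ∀ z, z ∉ U → k₀ z = 0 := fun z hz => by
    have h1 : h z = 0 := hh0 fun h' => hz h'.1
    have h2 : h z⁻¹ = 0 := hh0 fun h' => hz (by simpa using h'.2)
    rw [hk₀, h1, h2, add_zero]
  have hint : ∀ u : C(Ω, ℝ), Integrable u ν := fun u =>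
    u.continuous.integrable_of_hasCompactSupport (HasCompactSupport.of_compactSpace _)
  have hpos : 0 < ∫ z, k₀ z ∂ν := by
    refine k₀.continuous.integral_pos_of_hasCompactSupport_nonneg_nonzero
      (HasCompactSupport.of_compactSpace _) hk₀nonneg (x := 1) ?_
    have h1 : h 1 = 1 := hh1 rfl
    rw [hk₀, inv_one, h1]
    norm_num
  set c := ∫ z, k₀ z ∂ν with hc
  let k₁ : C(Ω, ℝ) := c⁻¹ • k₀
  have hk₁ : ∀ z, k₁ z = c⁻¹ * k₀ z := fun z => rfl
  have hk₁nonneg : ∀ z, 0 ≤ k₁ z := fun z => mul_nonneg (inv_nonneg.2 hpos.le) (hk₀nonneg z)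
  have hk₁symm : ∀ z, k₁ z⁻¹ = k₁ z := fun z => by
    rw [hk₁, hk₁, hk₀, hk₀, inv_inv, add_comm]
  have hk₁int : ∀ x, ∫ y, k₁ (x * y⁻¹) ∂ν = 1 := fun x => by
    have h1 : ∀ y, k₁ (x * y⁻¹) = k₁ (y * x⁻¹) := fun y => by
      rw [← hk₁symm, mul_inv_rev, inv_inv]
    simp_rw [h1]
    rw [integral_mul_right_eq_self (fun z => k₁ z) x⁻¹]
    simp_rw [hk₁]
    rw [integral_const_mul, ← hc, inv_mul_cancel₀ hpos.ne']
  refine ⟨⟨fun z => (k₁ z : ℂ), Complex.continuous_ofReal.comp k₁.continuous⟩, fun z => ?_, ?_⟩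
  · change star ((k₁ z⁻¹ : ℝ) : ℂ) = k₁ z
    rw [hk₁symm]
    exact Complex.conj_ofReal _
  · refine (ContinuousMap.norm_le _ hε.le).2 fun x => ?_
    have hcx : Continuous fun y : Ω => k₁ (x * y⁻¹) :=
      k₁.continuous.comp (continuous_const.mul continuous_inv)
    have hcx' : Continuous fun y : Ω => (k₁ (x * y⁻¹) : ℂ) := Complex.continuous_ofReal.comp hcx
    have hintc : ∀ {u : Ω → ℂ}, Continuous u → Integrable u ν := fun hu =>
      hu.integrable_of_hasCompactSupport (HasCompactSupport.of_compactSpace _)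
    have h1 : f x = ∫ y, (k₁ (x * y⁻¹) : ℂ) * f x ∂ν := by
      rw [integral_mul_const, integral_complex_ofReal, hk₁int, Complex.ofReal_one, one_mul]
    rw [ContinuousMap.sub_apply, kernelOp_toLp]
    change ‖∫ y, (k₁ (x * y⁻¹) : ℂ) * f y ∂ν - f x‖ ≤ ε
    conv_lhs => rw [h1]
    have hi₁ : Integrable (fun y => (k₁ (x * y⁻¹) : ℂ) * f y) ν := hintc (hcx'.mul f.continuous)
    have hi₂ : Integrable (fun y => (k₁ (x * y⁻¹) : ℂ) * f x) ν :=
      hintc (hcx'.mul continuous_const)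
    rw [← integral_sub hi₁ hi₂]
    have h2 : ∫ y, k₁ (x * y⁻¹) * ε ∂ν = ε := by
      rw [integral_mul_const, hk₁int, one_mul]
    rw [← h2]
    refine norm_integral_le_of_norm_le ((hint ⟨_, hcx⟩).mul_const ε) (.of_forall fun y => ?_)
    rw [← mul_sub, norm_mul, Complex.norm_real, Real.norm_of_nonneg (hk₁nonneg _)]
    by_cases hxy : x * y⁻¹ ∈ U
    · exact mul_le_mul_of_nonneg_left (hUf x y hxy) (hk₁nonneg _)
    · have h0 : k₁ (x * y⁻¹) = 0 := by rw [hk₁, hk₀U _ hxy, mul_zero]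
      rw [h0, zero_mul, zero_mul]

end PeterWeyl

/-- The **Peter–Weyl theorem**: the span of the matrix coefficients of the irreducible unitary
representations of a compact group is uniformly dense. -/
theorem dense_matrixCoeffSpan {Ω : Type*} [Group Ω] [TopologicalSpace Ω] [IsTopologicalGroup Ω]
    [CompactSpace Ω] [T2Space Ω] : Dense (matrixCoeffSpan Ω : Set C(Ω, ℂ)) := by
  let _ : MeasurableSpace Ω := borel Ω
  have : BorelSpace Ω := ⟨rfl⟩
  let ν : Measure Ω := Measure.haarMeasure ⊤
  have : IsProbabilityMeasure ν := ⟨Measure.haarMeasure_self⟩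
  have := isMulRightInvariant_of_compactSpace ν
  intro f
  rw [Metric.mem_closure_iff]
  intro ε hε
  obtain ⟨k, hk, hkf⟩ := exists_norm_kernelOp_sub_lt (ν := ν) f (half_pos (half_pos hε))
  have hmem := kernelOp_mem_closure_matrixCoeffSpan hk (ContinuousMap.toLp 2 ν ℂ f)
  obtain ⟨b, hb, hbd⟩ := Metric.mem_closure_iff.1 hmem (ε / 2) (half_pos hε)
  refine ⟨b, hb, ?_⟩
  rw [← dist_eq_norm, dist_comm] at hkf
  have := dist_triangle f (kernelOp ν (convKernel k) (ContinuousMap.toLp 2 ν ℂ f)) b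
  linarith

/-! ### Mean ergodicity of the skew product -/

/-- The coordinate functions of all irreducible representations are total in `C(K × Ω)`, by the
Peter–Weyl theorem. -/
theorem dense_span_coordMap (K Ω : Type*) [TopologicalSpace K] [CompactSpace K] [T2Space K]
    [Group Ω] [TopologicalSpace Ω] [IsTopologicalGroup Ω] [CompactSpace Ω] [T2Space Ω] :
    Dense (Submodule.span ℂ {F : C(K × Ω, ℂ) | ∃ (N : ℕ) (π : Ω →ₜ* UN N) (_ : π ∈ irreps Ω N)
      (v : CN N) (f : C(K, CN N)), F = coordMap K π v f} : Set C(K × Ω, ℂ)) := by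
  set D : Set C(K × Ω, ℂ) := {F | ∃ (N : ℕ) (π : Ω →ₜ* UN N) (_ : π ∈ irreps Ω N)
      (v : CN N) (f : C(K, CN N)), F = coordMap K π v f}
  let S := (Submodule.span ℂ D).topologicalClosure
  have hS : IsClosed (S : Set C(K × Ω, ℂ)) := Submodule.isClosed_topologicalClosure _
  have htensor : ∀ (u : C(K, ℂ)) (c : C(Ω, ℂ)), ContinuousMap.prodMul u c ∈ S := by
    intro u
    have hcont : Continuous fun c : C(Ω, ℂ) => ContinuousMap.prodMul u c := by
      simp_rw [ContinuousMap.prodMul_def]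
      exact continuous_const.mul (ContinuousMap.continuous_precomp _)
    have hle : matrixCoeffSpan Ω ≤ S.comap (ContinuousMap.prodMul u) := by
      refine Submodule.span_le.2 ?_
      rintro c ⟨N, π, hπ, v, w, hc⟩
      refine Submodule.le_topologicalClosure _ (Submodule.subset_span
        ⟨N, π, hπ, v, ⟨fun x => u x • w, u.continuous.smul continuous_const⟩, ?_⟩)
      ext p
      rw [ContinuousMap.prodMul_apply, hc, coordMap_apply, ← inner_smul_right, ← map_smul]
      rfl
    exact fun c => closure_minimal hle (hS.preimage hcont) (dense_matrixCoeffSpan c)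
  have hle : Submodule.span ℂ
      (range fun p : C(K, ℂ) × C(Ω, ℂ) => ContinuousMap.prodMul p.1 p.2) ≤ S := by
    refine Submodule.span_le.2 ?_
    rintro _ ⟨p, rfl⟩
    exact htensor p.1 p.2
  exact fun F => closure_minimal hle hS (dense_span_prodMul F)

end SkewErgodic

end

theorem mainTheorem7
    {G : Type*} [Semigroup G] [TopologicalSpace G] [SeparatelyContinuousMul G]
    (hG : SkewErgodic.KoopmanRightAmenable G)
    {K : Type*} [TopologicalSpace K] [CompactSpace K] [T2Space K]
    [MeasurableSpace K] [BorelSpace K]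
    [SemigroupAction G K] [ContinuousSMul G K]
    (hK : SkewErgodic.IsUniquelyErgodic G K)
    (μ : Measure K) [IsProbabilityMeasure μ] [μ.Regular] [SMulInvariantMeasure G K μ]
    {Ω : Type*} [Group Ω] [TopologicalSpace Ω] [IsTopologicalGroup Ω]
    [CompactSpace Ω] [T2Space Ω]
    (γ : SkewErgodic.ContinuousCocycle G K Ω) :
    SkewErgodic.IsMeanErgodic (SkewErgodic.skewKoopman γ) ↔
      ∀ (N : ℕ), ∀ π ∈ SkewErgodic.irreps Ω N,
        SkewErgodic.fixedSpace (SkewErgodic.koopmanL2 μ (γ.map π)) ≤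
          (SkewErgodic.fixedSpace (SkewErgodic.koopmanC (γ.map π))).map
            (ContinuousMap.toLp (E := SkewErgodic.CN N) 2 μ ℂ).toLinearMap := by

  constructor
  · intro hT N π _
    exact SkewErgodic.fixedSpace_koopmanL2_le hG hK (γ.map π)
      (SkewErgodic.exists_fixed_of_isMeanErgodic γ π hT)
  · intro h
    refine SkewErgodic.isMeanErgodic_of_dense_span hG (SkewErgodic.norm_skewKoopman_le γ)
      (SkewErgodic.continuous_skewKoopman γ) (SkewErgodic.skewKoopman_mul γ)
      (SkewErgodic.dense_span_coordMap K Ω) ?_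
    rintro _ ⟨N, π, hπ, v, f, rfl⟩
    obtain ⟨f₀, hf₀, hmem⟩ :=
      SkewErgodic.exists_fixed_mem_closure_koopmanC hG hK (γ.map π) (h N π hπ) f
    exact SkewErgodic.exists_fixed_mem_closure_coordMap γ π v hf₀ hmem
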